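/- A quasi-norm with constant $C\ge 1$ on a real vector space $E$ is a map $\|\cdot\|\colon E\to[0,\infty)$ with $\|x\|=0$ iff $x=0$, $\|ax\|=|a|\,\|x\|$ for $a\in\mathbb{R}$, and $\|x+y\|\le C(\|x\|+\|y\|)$. A basis $e_1,\dots,e_n$ of $E$ is called symmetric for $\|\cdot\|$ if $\big\|\sum_{i} a_i e_i\big\|=\big\|\sum_{i}\varepsilon_i a_{\pi(i)}e_i\big\|$ for all $a\in\mathbb{R}^n$, all signs $\varepsilon_i\in\{-1,1\}$ and all permutations $\pi$ of $\{1,\dots,n\}$. Let $E$ be an $n$-dimensional real vector space, let $X=(E,\|\cdot\|_X)$ and $Y=(E,\|\cdot\|_Y)$ be quasi-Banach spaces with quasi-norm constants $C_X,C_Y\ge 1$ and closed unit balls $B_X,B_Y$, and let $e_1,\dots,e_n$ be a basis of $E$ that is symmetric for both $\|\cdot\|_X$ and $\|\cdot\|_Y$. For an integer $k\ge 1$ let $$e_k(\mathrm{id}\colon X\to Y)=\inf\Big\{\varepsilon>0:\ \exists\, y_1,\dots,y_{2^{k-1}}\in Y,\ B_X\subset\bigcup_{i=1}^{2^{k-1}}(y_i+\varepsilon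 B_Y)\Big\}$$ be the $k$-th dyadic entropy number of the identity, and for $s\in\mathbb{N}$ and $x\in E$ let $$\sigma_s(x)_Y=\inf\Big\{\|x-z\|_Y:\ z=\sum_{i=1}^n z_ie_i,\ |\{i: z_i\ne 0\}|\le s\Big\}$$ be the error of best $s$-term approximation. **Proposition.** For every $C\ge 1$ there are constants $c_1,c_2>0$, depending only on $C$, such that for all $n$, $X$, $Y$ and $e_1,\dots,e_n$ as above with $\max\{C_X,C_Y\}\le C$ and all integers $k$ with $1\le k<n/2$, $$c_1\,\sup_{x\in B_X}\sigma_s(x)_Y\ \le\ e_k(\mathrm{id}\colon X\to Y)\ \le\ c_2\,\sup_{x\in B_X}\sigma_s(x)_Y,$$ where $s$ is the least integer with $s>\dfrac{k}{\log(n/k+1)}$ and $\log$ is the natural logarithm. -/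

import Mathlib

/-- `N` is a quasi-norm with constant `C ≥ 1` on the real vector space `E`. On a finite-dimensional
space a quasi-norm is automatically complete, so `(E, N)` is then a quasi-Banach space. -/
structure IsQuasiNorm {E : Type*} [AddCommGroup E] [Module ℝ E] (N : E → ℝ) (C : ℝ) : Prop where
  one_le : 1 ≤ C
  nonneg : ∀ x, 0 ≤ N x
  eq_zero_iff : ∀ x, N x = 0 ↔ x = 0
  smul : ∀ (a : ℝ) (x : E), N (a • x) = |a| * N x
  add_le : ∀ x y, N (x + y) ≤ C * (N x + N y)

/-- The basis `b` is (1-)symmetric for `N`: the value of `N` does not change under permutations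
and changes of signs of the coefficients. -/
def IsSymmetricBasis {E ι : Type*} [AddCommGroup E] [Module ℝ E] [Fintype ι]
    (N : E → ℝ) (b : Module.Basis ι ℝ E) : Prop :=
  ∀ (a ε : ι → ℝ) (π : Equiv.Perm ι), (∀ i, ε i = 1 ∨ ε i = -1) →
    N (∑ i, a i • b i) = N (∑ i, (ε i * a (π i)) • b i)

/-- The closed unit ball of `N`. -/
def quasiUnitBall {E : Type*} (N : E → ℝ) : Set E := {x | N x ≤ 1}

/-- The radii `ε > 0` such that the image under `T` of the unit ball of `NX` is covered by
`2 ^ (k - 1)` translates of `ε` times the unit ball of `NY` (used for `k ≥ 1`). -/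
def entropyRadii {E F : Type*} [AddCommGroup E] [Module ℝ E] [AddCommGroup F] [Module ℝ F]
    (NX : E → ℝ) (NY : F → ℝ) (T : E →ₗ[ℝ] F) (k : ℕ) : Set ℝ :=
  {ε | 0 < ε ∧ ∃ y : Fin (2 ^ (k - 1)) → F,
    T '' quasiUnitBall NX ⊆ ⋃ i, (fun z => y i + ε • z) '' quasiUnitBall NY}

/-- The `k`-th dyadic entropy number of `T : (E, NX) → (F, NY)`. -/
noncomputable def entropyNumber {E F : Type*} [AddCommGroup E] [Module ℝ E]
    [AddCommGroup F] [Module ℝ F] (NX : E → ℝ) (NY : F → ℝ) (T : E →ₗ[ℝ] F) (k : ℕ) : ℝ :=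
  sInf (entropyRadii NX NY T k)

/-- The error, in `N`, of best `s`-term approximation of `x` with respect to the basis `b`. -/
noncomputable def bestTermError {E ι : Type*} [AddCommGroup E] [Module ℝ E]
    (N : E → ℝ) (b : Module.Basis ι ℝ E) (s : ℕ) (x : E) : ℝ :=
  sInf {r | ∃ z : E, (b.repr z).support.card ≤ s ∧ r = N (x - z)}

/-- The identity between two quasi-norms with a common symmetric basis is bounded. -/
theorem IsSymmetricBasis.exists_bound {E ι : Type*} [AddCommGroup E] [Module ℝ E] [Fintype ι]
    {NX NY : E → ℝ} {CX CY : ℝ} (hX : IsQuasiNorm NX CX) (hY : IsQuasiNorm NY CY)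
    {b : Module.Basis ι ℝ E} (hb : IsSymmetricBasis NX b) :
    ∃ K : ℝ, 0 ≤ K ∧ ∀ x, NY x ≤ K * NX x := by
  classical
  have coef : ∀ x j, |b.repr x j| * NX (b j) ≤ CX * NX x := by
    intro x j
    have h := hb (fun i => b.repr x i) (fun i => if i = j then 1 else -1) 1
      (fun i => by by_cases h : i = j <;> simp [h])
    rw [b.sum_repr] at h
    set x' := ∑ i, ((if i = j then (1 : ℝ) else -1) * b.repr x ((1 : Equiv.Perm ι) i)) • b i
      with hx'
    have hs : x + x' = (2 * b.repr x j) • b j := by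
      conv_lhs => rw [← b.sum_repr x, hx', ← Finset.sum_add_distrib]
      rw [Finset.sum_eq_single j]
      · simp [two_mul, add_smul]
      · intro i _ hij
        simp [hij]
      · simp
    have h2 := hX.add_le x x'
    rw [hs, hX.smul, ← h, abs_mul, abs_two] at h2
    linarith
  have pos : ∀ j, 0 < NX (b j) := fun j =>
    lt_of_le_of_ne (hX.nonneg _) fun h =>
      b.ne_zero j ((hX.eq_zero_iff _).1 h.symm)
  have key : ∀ S : Finset ι, ∃ K : ℝ, 0 ≤ K ∧
      ∀ x, NY (∑ i ∈ S, b.repr x i • b i) ≤ K * NX x := by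
    intro S
    induction S using Finset.induction_on with
    | empty => exact ⟨0, le_rfl, fun x => by simp [(hY.eq_zero_iff 0).2 rfl]⟩
    | insert j S hj ih =>
      obtain ⟨K, hK, h⟩ := ih
      have hCX : 0 ≤ CX := by linarith [hX.one_le]
      have hCY : 0 ≤ CY := by linarith [hY.one_le]
      have hq : 0 ≤ CX / NX (b j) * NY (b j) :=
        mul_nonneg (div_nonneg hCX (pos j).le) (hY.nonneg _)
      refine ⟨CY * (CX / NX (b j) * NY (b j) + K), mul_nonneg hCY (add_nonneg hq hK), fun x => ?_⟩
      rw [Finset.sum_insert hj]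
      refine (hY.add_le _ _).trans ?_
      rw [mul_assoc]
      refine mul_le_mul_of_nonneg_left ?_ hCY
      rw [add_mul, hY.smul]
      refine add_le_add ?_ (h x)
      have h1 : |b.repr x j| ≤ CX * NX x / NX (b j) := (le_div_iff₀ (pos j)).2 (coef x j)
      calc |b.repr x j| * NY (b j) ≤ CX * NX x / NX (b j) * NY (b j) :=
            mul_le_mul_of_nonneg_right h1 (hY.nonneg _)
        _ = _ := by ring
  obtain ⟨K, hK, h⟩ := key Finset.univ
  exact ⟨K, hK, fun x => by simpa only [b.sum_repr] using h x⟩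

/-- The infimum that defines the entropy numbers of the identity is over a nonempty set. -/
theorem IsSymmetricBasis.entropyRadii_nonempty {E ι : Type*} [AddCommGroup E] [Module ℝ E]
    [Fintype ι] {NX NY : E → ℝ} {CX CY : ℝ} (hX : IsQuasiNorm NX CX) (hY : IsQuasiNorm NY CY)
    {b : Module.Basis ι ℝ E} (hb : IsSymmetricBasis NX b) (k : ℕ) :
    (entropyRadii NX NY LinearMap.id k).Nonempty := by
  obtain ⟨K, hK, h⟩ := hb.exists_bound hX hY
  have hK1 : 0 < K + 1 := by linarith
  refine ⟨K + 1, hK1, fun _ => 0, ?_⟩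
  rintro _ ⟨x, hx, rfl⟩
  refine Set.mem_iUnion.2 ⟨⟨0, by positivity⟩, (K + 1)⁻¹ • x, ?_, ?_⟩
  · have hx1 : NX x ≤ 1 := hx
    change NY _ ≤ 1
    rw [hY.smul, abs_of_pos (inv_pos.2 hK1), inv_mul_le_iff₀ hK1]
    nlinarith [h x]
  · simp [smul_smul, hK1.ne']

/-- The best `s`-term approximation errors are bounded on the unit ball. -/
theorem IsSymmetricBasis.bddAbove_bestTermError {E ι : Type*} [AddCommGroup E] [Module ℝ E]
    [Fintype ι] {NX NY : E → ℝ} {CX CY : ℝ} (hX : IsQuasiNorm NX CX) (hY : IsQuasiNorm NY CY)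
    {b : Module.Basis ι ℝ E} (hb : IsSymmetricBasis NX b) (s : ℕ) :
    BddAbove (bestTermError NY b s '' quasiUnitBall NX) := by
  obtain ⟨K, hK, h⟩ := hb.exists_bound hX hY
  refine ⟨K, ?_⟩
  rintro _ ⟨x, hx, rfl⟩
  have hx1 : NX x ≤ 1 := hx
  have h1 : bestTermError NY b s x ≤ NY x := by
    refine csInf_le ⟨0, ?_⟩ ⟨0, by simp, by simp⟩
    rintro _ ⟨z, _, rfl⟩
    exact hY.nonneg _
  nlinarith [h x]

/-!
Entropy numbers of the identity between symmetric quasi-normed spaces and best `s`-term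
approximation, with `s` about `k / log (n / k + 1)`.

In coordinates both quasi-norms depend only on the non-increasing rearrangement `u` of the absolute
values, and up to constants the error of best `s`-term approximation is the quasi-norm of the tail
of `u` after the first `s` coordinates. All estimates between quasi-norms come from one principle,
`IsSymmQuasiNorm.le_of_dominatedBy`: if the coordinates of `x` are matched with larger coordinates
of `y`, each of the latter being used at most `R` times, then `N x ≤ domConst C R * N y`, where
`domConst C R` grows polynomially in `R`.

*Lower estimate.* Out of a vector `u` of the unit ball of `X` one builds many vectors of bounded
`X`-norm, indexed by the words of a code (`wordVector`). Column `c` of the coordinates is divided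
into cells, the word chooses a cell and a sign, and the chosen cells carry the same values, sampled
from `u`. Two words of a code with large distance give vectors whose difference dominates a segment
of `u`, so two of them in the same ball of the cover bound the `Y`-norm of that segment
(`le_of_cover_of_code`). Sign patterns of length `2 * k` handle the coordinates from `k` on
(`tail_le_of_cover`); words of length `4 * s` over about `n / k` letters handle the coordinates
between `s` and `k` (`segment_le_of_cover`). The required codes exist by the Gilbert–Varshamov
bound, because `(n / k + 1) ^ s > exp k`.

*Upper estimate.* Let `σ` be the supremum of the tails and `A` a large constant. The tail after the
`s / A` largest coordinates is still of size `σ`, by repeating coordinates (`shorter_tail_le`). The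
`s / A` largest coordinates are rounded to the lattice with the mesh for which a flat vector of
length `s` has norm `σ`. The `i`-th largest rounded coordinate is at most a constant times a power
of `s / i` (`coord_mul_le`), hence the product of the coordinates is exponential in `s / A`, and the
sparse integer vectors that occur can be counted by a generating function (`exists_finset_sparse`).
Their number is at most `2 ^ (k - 1)` if `A` is large enough (`exists_scale`).
-/

/-! ### Symmetric quasi-norms on `ℝⁿ` -/

/-- A quasi-norm on `ℝⁿ` which depends only on the absolute values of the coordinates, up to a
permutation: a quasi-norm for which the standard basis is symmetric. -/
structure IsSymmQuasiNorm {n : ℕ} (N : (Fin n → ℝ) → ℝ) (C : ℝ) : Prop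
    extends IsQuasiNorm N C where
  symm : ∀ (x y : Fin n → ℝ) (π : Equiv.Perm (Fin n)), (∀ i, |x i| = |y (π i)|) → N x = N y

theorem IsQuasiNorm.map_zero {E : Type*} [AddCommGroup E] [Module ℝ E] {N : E → ℝ} {C : ℝ}
    (h : IsQuasiNorm N C) : N 0 = 0 := (h.eq_zero_iff 0).2 rfl

theorem IsQuasiNorm.sum_le {E ι : Type*} [AddCommGroup E] [Module ℝ E] {N : E → ℝ} {C : ℝ}
    (h : IsQuasiNorm N C) (S : Finset ι) (v : ι → E) :
    N (∑ i ∈ S, v i) ≤ C ^ S.card * ∑ i ∈ S, N (v i) := by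
  classical
  have h1 := h.one_le
  have hC : 0 ≤ C := by linarith
  induction S using Finset.induction_on with
  | empty => simp [h.map_zero]
  | insert j S hj ih =>
    rw [Finset.sum_insert hj, Finset.sum_insert hj, Finset.card_insert_of_notMem hj]
    refine (h.add_le _ _).trans ?_
    rw [pow_succ', mul_assoc]
    refine mul_le_mul_of_nonneg_left ?_ hC
    rw [mul_add]
    refine add_le_add ?_ ih
    exact le_mul_of_one_le_left (h.nonneg _) (one_le_pow₀ h1)

/-- The constant in the lattice property of a symmetric quasi-norm. -/
noncomputable def latticeConst (C : ℝ) : ℝ := 2 * C ^ (⌈2 * C⌉₊ + 2)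

theorem latticeConst_pos {C : ℝ} (hC : 1 ≤ C) : 0 < latticeConst C := by
  have : 0 < C := by linarith
  unfold latticeConst; positivity

namespace IsSymmQuasiNorm

variable {n : ℕ} {N : (Fin n → ℝ) → ℝ} {C : ℝ}

theorem pos (h : IsSymmQuasiNorm N C) : 0 < C := by linarith [h.one_le]

theorem congr_abs (h : IsSymmQuasiNorm N C) {x y : Fin n → ℝ} (hxy : ∀ i, |x i| = |y i|) :
    N x = N y := h.symm x y 1 hxy

theorem indicator_le (h : IsSymmQuasiNorm N C) (p : Fin n → Prop) [DecidablePred p]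
    (x : Fin n → ℝ) : N (fun i => if p i then x i else 0) ≤ C * N x := by
  -- a coordinate projection is the mean of the identity and a change of signs
  have e : (fun i => if p i then x i else 0)
      = (1 / 2 : ℝ) • (x + fun i => if p i then x i else - x i) := by
    funext i
    by_cases hi : p i <;> simp [hi]
    ring
  have e2 : N (fun i => if p i then x i else - x i) = N x :=
    h.congr_abs fun i => by by_cases hi : p i <;> simp [hi]
  rw [e, h.smul]
  have := h.add_le x (fun i => if p i then x i else - x i)
  rw [e2] at this
  rw [abs_of_pos (by norm_num)]
  linarith

theorem exists_bound (h : IsSymmQuasiNorm N C) :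
    ∃ K, 0 ≤ K ∧ ∀ (x : Fin n → ℝ) (r : ℝ), 0 ≤ r → (∀ i, |x i| ≤ r) → N x ≤ K * r := by
  have hC := h.pos
  refine ⟨C ^ n * ∑ i, N (Pi.single i 1), ?_, fun x r hr hx => ?_⟩
  · exact mul_nonneg (by positivity) (Finset.sum_nonneg fun i _ => h.nonneg _)
  · have e : x = ∑ i, x i • (Pi.single i 1 : Fin n → ℝ) := by
      funext j
      simp [Finset.sum_apply, Pi.single_apply]
    calc N x = N (∑ i, x i • (Pi.single i 1 : Fin n → ℝ)) := by rw [← e]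
      _ ≤ C ^ n * ∑ i, N (x i • (Pi.single i 1 : Fin n → ℝ)) := by
          simpa using h.sum_le Finset.univ (fun i => x i • (Pi.single i 1 : Fin n → ℝ))
      _ ≤ C ^ n * ∑ i, N (Pi.single i 1) * r := by
          gcongr with i
          rw [h.smul, mul_comm]
          exact mul_le_mul_of_nonneg_left (hx i) (h.nonneg _)
      _ = _ := by rw [← Finset.sum_mul, mul_assoc]

/-- Multipliers with values in `[0, 1]` are bounded by a constant that depends only on `C`.  The
multiplier is expanded in a base `M ≥ 2 * C`: its first digit is a sum of coordinate projections,
and the remainder is a multiplier of the same kind, scaled by `1 / M`. -/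
theorem multiplier_le (h : IsSymmQuasiNorm N C) (x t : Fin n → ℝ) (ht0 : ∀ i, 0 ≤ t i)
    (ht1 : ∀ i, t i ≤ 1) : N (fun i => t i * x i) ≤ latticeConst C * N x := by
  have hC := h.pos
  have h1 := h.one_le
  obtain ⟨K, hK, hb⟩ := h.exists_bound
  set T : Set ℝ := {r | ∃ t : Fin n → ℝ, (∀ i, 0 ≤ t i) ∧ (∀ i, t i ≤ 1) ∧
    r = N (fun i => t i * x i)} with hT
  have hbd : BddAbove T := by
    refine ⟨K * ∑ i, |x i|, ?_⟩
    rintro _ ⟨t, h0, h1, rfl⟩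
    refine hb _ _ (Finset.sum_nonneg fun i _ => abs_nonneg _) fun i => ?_
    rw [abs_mul, abs_of_nonneg (h0 i)]
    calc t i * |x i| ≤ 1 * |x i| := by gcongr; exact h1 i
      _ = |x i| := one_mul _
      _ ≤ _ := Finset.single_le_sum (f := fun i => |x i|) (fun i _ => abs_nonneg _)
        (Finset.mem_univ i)
  have hne : T.Nonempty := ⟨_, t, ht0, ht1, rfl⟩
  set M : ℕ := ⌈2 * C⌉₊ with hM
  have hMC : 2 * C ≤ M := Nat.le_ceil _
  have hM0 : (0 : ℝ) < M := by linarith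
  have hstep : ∀ r ∈ T, r ≤ C * (C ^ (M + 1) * N x + sSup T / M) := by
    rintro _ ⟨t, h0, h1, rfl⟩
    set d : Fin n → ℕ := fun i => min ⌊M * t i⌋₊ (M - 1) with hd
    have hMn : 0 < M := by exact_mod_cast hM0
    have hdM : ∀ i, d i < M := fun i => by
      have := min_le_right ⌊M * t i⌋₊ (M - 1)
      simp only [hd]; omega
    have hd1 : ∀ i, (d i : ℝ) ≤ M * t i := fun i =>
      (Nat.cast_le.2 (min_le_left _ _)).trans (Nat.floor_le (by have := h0 i; positivity))
    have hd2 : ∀ i, M * t i ≤ d i + 1 := fun i => by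
      rcases le_total ⌊M * t i⌋₊ (M - 1) with hle | hle
      · simp only [hd, min_eq_left hle]
        exact (Nat.lt_floor_add_one _).le
      · simp only [hd, min_eq_right hle]
        rw [Nat.cast_sub hMn]
        have := h1 i
        push_cast
        nlinarith
    have e : (fun i => t i * x i)
        = (∑ j ∈ Finset.range M, (1 / M : ℝ) • fun i => if j < d i then x i else 0)
          + (1 / M : ℝ) • fun i => (M * t i - d i) * x i := by
      funext i
      have hcard : ((Finset.range M).filter (· < d i)).card = d i := by
        have : (Finset.range M).filter (· < d i) = Finset.range (d i) := by
          ext j; simp only [Finset.mem_filter, Finset.mem_range]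
          have := hdM i; omega
        rw [this, Finset.card_range]
      simp only [Pi.add_apply, Finset.sum_apply, Pi.smul_apply, smul_eq_mul, mul_ite, mul_zero]
      rw [← Finset.sum_filter, Finset.sum_const, hcard, nsmul_eq_mul]
      field_simp
      ring
    rw [e]
    refine (h.add_le _ _).trans (mul_le_mul_of_nonneg_left (add_le_add ?_ ?_) hC.le)
    · refine (h.sum_le _ _).trans ?_
      rw [Finset.card_range, pow_succ, mul_assoc]
      refine mul_le_mul_of_nonneg_left ?_ (by positivity)
      calc ∑ j ∈ Finset.range M, N ((1 / M : ℝ) • fun i => if j < d i then x i else 0)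
          ≤ ∑ j ∈ Finset.range M, (1 / M : ℝ) * (C * N x) := by
            refine Finset.sum_le_sum fun j _ => ?_
            rw [h.smul, abs_of_pos (by positivity)]
            exact mul_le_mul_of_nonneg_left (h.indicator_le _ x) (by positivity)
        _ = C * N x := by
            rw [Finset.sum_const, Finset.card_range, nsmul_eq_mul]; field_simp
    · rw [h.smul, abs_of_pos (by positivity), one_div, inv_mul_eq_div]
      refine div_le_div_of_nonneg_right (le_csSup hbd ⟨_, ?_, ?_, rfl⟩) hM0.le
      · intro i; linarith [hd1 i]
      · intro i; linarith [hd2 i]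
  have hsup : sSup T ≤ C * (C ^ (M + 1) * N x + sSup T / M) := csSup_le hne hstep
  have hS0 : 0 ≤ sSup T := (h.nonneg _).trans (le_csSup hbd ⟨t, ht0, ht1, rfl⟩)
  have hhalf : C * (sSup T / M) ≤ sSup T / 2 := by
    rw [mul_div_assoc', div_le_div_iff₀ hM0 two_pos]
    nlinarith
  have : sSup T ≤ latticeConst C * N x := by
    have e : latticeConst C * N x = 2 * (C * (C ^ (M + 1) * N x)) := by
      rw [latticeConst, ← hM]; ring
    rw [e]; linarith
  exact (le_csSup hbd ⟨t, ht0, ht1, rfl⟩).trans this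

/-- The lattice property; it holds with a constant only, as quasi-norms need not be monotone. -/
theorem le_of_abs_le (h : IsSymmQuasiNorm N C) {x y : Fin n → ℝ} (hxy : ∀ i, |x i| ≤ |y i|) :
    N x ≤ latticeConst C * N y := by
  have e : N x = N (fun i => (|x i| / |y i|) * y i) := by
    refine h.congr_abs fun i => ?_
    by_cases hy : y i = 0
    · have := hxy i
      rw [hy, abs_zero] at this
      simp [hy, le_antisymm this (abs_nonneg _)]
    · rw [abs_mul, abs_div, abs_abs, abs_abs, div_mul_cancel₀ _ (abs_ne_zero.2 hy)]
  rw [e]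
  exact h.multiplier_le _ _ (fun i => by positivity) fun i =>
    div_le_one_of_le₀ (hxy i) (abs_nonneg _)

end IsSymmQuasiNorm

/-- The coordinates of `x` are dominated by those of `y`, each coordinate of `y` being used at most
`R` times: `φ` says which coordinate of `y` is used, and `ρ < R` tells the uses apart. -/
def DominatedBy {n : ℕ} (R : ℕ) (x y : Fin n → ℝ) : Prop :=
  ∃ (φ : Fin n → Fin n) (ρ : Fin n → ℕ), (∀ i, x i ≠ 0 → ρ i < R ∧ |x i| ≤ |y (φ i)|) ∧
    ∀ i j, x i ≠ 0 → x j ≠ 0 → φ i = φ j → ρ i = ρ j → i = j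

/-- The constant with which domination with multiplicity `R` is reflected by quasi-norms. -/
noncomputable def domConst (C : ℝ) (R : ℕ) : ℝ := latticeConst C * (2 * C) ^ Nat.clog 2 R

theorem domConst_pos {C : ℝ} (hC : 1 ≤ C) (R : ℕ) : 0 < domConst C R := by
  have := latticeConst_pos hC
  have : 0 < C := by linarith
  unfold domConst; positivity

/-- Each doubling of the multiplicity splits the vector into two and costs a factor `2 * C`. -/
theorem IsSymmQuasiNorm.le_of_dominatedBy_two_pow {n : ℕ} {N : (Fin n → ℝ) → ℝ} {C : ℝ}
    (h : IsSymmQuasiNorm N C) {y : Fin n → ℝ} (l : ℕ) :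
    ∀ {x : Fin n → ℝ}, DominatedBy (2 ^ l) x y → N x ≤ latticeConst C * (2 * C) ^ l * N y := by
  classical
  induction l with
  | zero =>
    rintro x ⟨φ, ρ, hd, hi⟩
    -- multiplicity one: `φ` is injective on the support of `x` and extends to a permutation
    obtain ⟨g, hg⟩ := Finset.exists_equiv_extend_of_card_eq (α := Fin n) (β := Fin n)
      (t := Finset.univ) (by simp) (s := Finset.univ.filter fun i => x i ≠ 0) (f := φ)
      (Finset.subset_univ _) (by
        intro i hxi j hxj hij
        simp only [Finset.coe_filter, Finset.mem_univ, true_and, Set.mem_ofPred_eq] at hxi hxj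
        refine hi i j hxi hxj hij ?_
        have h1 := (hd i hxi).1
        have h2 := (hd j hxj).1
        omega)
    have e : N y = N (fun i => y (g i : Fin n)) :=
      (h.symm (fun i => y (g i : Fin n)) y (g.trans (Equiv.subtypeUnivEquiv Finset.mem_univ))
        fun i => rfl).symm
    rw [e, pow_zero, mul_one]
    refine h.le_of_abs_le fun i => ?_
    by_cases hxi : x i = 0
    · simp [hxi]
    · rw [hg i (by simpa using hxi)]
      exact (hd i hxi).2
  | succ l ih =>
    rintro x ⟨φ, ρ, hd, hi⟩
    have hl : DominatedBy (2 ^ l) (fun i => if ρ i < 2 ^ l then x i else 0) y := by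
      refine ⟨φ, ρ, fun i hxi => ?_, fun i j hxi hxj h1 h2 => ?_⟩
      · by_cases hp : ρ i < 2 ^ l <;> simp only [hp, if_true, if_false] at hxi ⊢
        · exact ⟨trivial, (hd i hxi).2⟩
        · exact absurd rfl hxi
      · by_cases hp : ρ i < 2 ^ l <;> by_cases hq : ρ j < 2 ^ l <;>
          simp only [hp, hq, if_true, if_false, ne_eq, not_true_eq_false] at hxi hxj
        exact hi i j hxi hxj h1 h2
    have hr : DominatedBy (2 ^ l) (fun i => if ρ i < 2 ^ l then 0 else x i) y := by
      refine ⟨φ, fun i => ρ i - 2 ^ l, fun i hxi => ?_, fun i j hxi hxj h1 h2 => ?_⟩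
      · by_cases hp : ρ i < 2 ^ l <;> simp only [hp, if_true, if_false] at hxi ⊢
        · exact absurd rfl hxi
        · have := (hd i hxi).1
          rw [pow_succ] at this
          exact ⟨by omega, (hd i hxi).2⟩
      · by_cases hp : ρ i < 2 ^ l <;> by_cases hq : ρ j < 2 ^ l <;>
          simp only [hp, hq, if_true, if_false, ne_eq, not_true_eq_false] at hxi hxj
        exact hi i j hxi hxj h1 (by dsimp only at h2; omega)
    have e : x = (fun i => if ρ i < 2 ^ l then x i else 0)
        + fun i => if ρ i < 2 ^ l then 0 else x i := by
      funext i
      by_cases hp : ρ i < 2 ^ l <;> simp [hp]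
    have h1 := ih hl
    have h2 := ih hr
    have hC := h.pos
    calc N x ≤ C * (N (fun i => if ρ i < 2 ^ l then x i else 0)
          + N (fun i => if ρ i < 2 ^ l then 0 else x i)) := by
          conv_lhs => rw [e]
          exact h.add_le _ _
      _ ≤ C * (latticeConst C * (2 * C) ^ l * N y + latticeConst C * (2 * C) ^ l * N y) := by
          gcongr
      _ = _ := by ring

theorem IsSymmQuasiNorm.le_of_dominatedBy {n : ℕ} {N : (Fin n → ℝ) → ℝ} {C : ℝ}
    (h : IsSymmQuasiNorm N C) {R : ℕ} {x y : Fin n → ℝ} (hxy : DominatedBy R x y) :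
    N x ≤ domConst C R * N y := by
  obtain ⟨φ, ρ, hd, hi⟩ := hxy
  exact h.le_of_dominatedBy_two_pow _ ⟨φ, ρ, fun i hxi =>
    ⟨(hd i hxi).1.trans_le (Nat.le_pow_clog one_lt_two R), (hd i hxi).2⟩, hi⟩

/-- The non-increasing rearrangement of the absolute values, extended by zero to a sequence. -/
theorem exists_antitone_rearrangement {n : ℕ} (x : Fin n → ℝ) :
    ∃ (u : ℕ → ℝ) (π : Equiv.Perm (Fin n)), Antitone u ∧ (∀ i, 0 ≤ u i) ∧
      ∀ i, |x i| = u (π i) := by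
  let σ := Tuple.sort (fun i => -|x i|)
  have hm : Monotone ((fun i => -|x i|) ∘ σ) := Tuple.monotone_sort _
  refine ⟨fun j => if hj : j < n then |x (σ ⟨j, hj⟩)| else 0, σ.symm, ?_, ?_, ?_⟩
  · intro i j hij
    by_cases hj : j < n
    · have hi : i < n := lt_of_le_of_lt hij hj
      have := @hm ⟨i, hi⟩ ⟨j, hj⟩ hij
      simp only [Function.comp] at this
      simp only [hi, hj, dif_pos]
      linarith
    · simp only [hj, dif_neg, not_false_eq_true]
      split_ifs <;> positivity
  · intro i
    dsimp only
    split_ifs <;> positivity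
  · intro i
    simp

/-- For a non-increasing non-negative vector, removing the first `s` coordinates is the best
`s`-term approximation, up to a constant. -/
theorem IsSymmQuasiNorm.tail_le {n : ℕ} {N : (Fin n → ℝ) → ℝ} {C : ℝ}
    (h : IsSymmQuasiNorm N C) {u : ℕ → ℝ} (hu : Antitone u) (hu0 : ∀ i, 0 ≤ u i) {s : ℕ}
    (z : Fin n → ℝ) (hz : (Finset.univ.filter fun i => z i ≠ 0).card ≤ s) :
    N (fun i => if s ≤ (i : ℕ) then u i else 0) ≤ domConst C 1 * N (fun i => u i - z i) := by
  classical
  refine h.le_of_dominatedBy ?_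
  set S := Finset.univ.filter fun i => z i ≠ 0 with hS
  rcases lt_or_ge n s with hn | hn
  · refine ⟨id, fun _ => 0, fun i hi => ?_, fun i j hi => ?_⟩
    · exact absurd (if_neg (by omega)) hi
    · exact absurd (if_neg (by omega)) hi
  -- the coordinates `≥ s` in the support of `z` are exchanged for coordinates `< s` outside of it
  set A := S.filter fun i : Fin n => s ≤ (i : ℕ) with hA
  set B := (Finset.univ.filter fun i : Fin n => (i : ℕ) < s) \ S with hB
  have hcard : A.card ≤ B.card := by
    have h1 : (Finset.univ.filter fun i : Fin n => (i : ℕ) < s).card = s := by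
      rw [Fin.card_filter_val_lt, min_eq_right hn]
    have h2 := Finset.card_sdiff_add_card_inter
      (Finset.univ.filter fun i : Fin n => (i : ℕ) < s) S
    have h3 := Finset.card_filter_add_card_filter_not (s := S) (fun i : Fin n => s ≤ (i : ℕ))
    have h4 : (Finset.univ.filter fun i : Fin n => (i : ℕ) < s) ∩ S
        = S.filter fun i : Fin n => ¬ s ≤ (i : ℕ) := by
      ext i; simp only [Finset.mem_inter, Finset.mem_filter, Finset.mem_univ, true_and, not_le]
      tauto
    rw [h4, ← hB] at h2
    rw [← hA] at h3
    omega
  obtain ⟨f⟩ : Nonempty (A ↪ B) := Function.Embedding.nonempty_of_card_le (by simpa using hcard)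
  have hfB : ∀ a, ((f a : Fin n) : ℕ) < s ∧ z (f a) = 0 := fun a => by
    obtain ⟨h1, h2⟩ := Finset.mem_sdiff.1 (f a).2
    refine ⟨(Finset.mem_filter.1 h1).2, ?_⟩
    by_contra hc
    exact h2 (Finset.mem_filter.2 ⟨Finset.mem_univ _, hc⟩)
  refine ⟨fun i => if hi : i ∈ A then f ⟨i, hi⟩ else i, fun _ => 0, fun i hi => ⟨one_pos, ?_⟩,
    fun i j hi hj hij _ => ?_⟩
  · have hsi : s ≤ (i : ℕ) := by by_contra hc; exact hi (if_neg hc)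
    simp only [if_pos hsi]
    by_cases hiA : i ∈ A
    · have h1 := hfB ⟨i, hiA⟩
      simp only [hiA, dif_pos, h1.2, sub_zero]
      rw [abs_of_nonneg (hu0 _), abs_of_nonneg (hu0 _)]
      exact hu (by omega)
    · have hz0 : z i = 0 := by
        by_contra hc
        exact hiA (by simp [hA, hS, hc, hsi])
      simp [hiA, hz0]
  · have hsi : s ≤ (i : ℕ) := by by_contra hc; exact hi (if_neg hc)
    have hsj : s ≤ (j : ℕ) := by by_contra hc; exact hj (if_neg hc)
    by_cases hiA : i ∈ A <;> by_cases hjA : j ∈ A <;> simp only [hiA, hjA, dif_pos, dif_neg,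
      not_false_eq_true] at hij
    · simpa using f.injective (Subtype.ext hij)
    · have := (hfB ⟨i, hiA⟩).1
      rw [hij] at this; omega
    · have := (hfB ⟨j, hjA⟩).1
      rw [← hij] at this; omega
    · exact hij

/-! ### Codes -/

/-- A ball in the Hamming metric has at most `x⁻ᵈ (1 + (|α| - 1) x)ᴺ` points, `d` being its radius,
since `1 ≤ x ^ (dist - d)` in the ball and the sum of `x ^ dist` over all words is a product. -/
theorem card_hammingBall_le {N d : ℕ} {α : Type*} [Fintype α] [DecidableEq α] (w : Fin N → α)
    {x : ℝ} (hx0 : 0 < x) (hx1 : x ≤ 1) :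
    ((Finset.univ.filter fun v : Fin N → α => hammingDist w v ≤ d).card : ℝ)
      ≤ (x ^ d)⁻¹ * (1 + (Fintype.card α - 1) * x) ^ N := by
  have hsum : ∑ v : Fin N → α, x ^ hammingDist w v = (1 + (Fintype.card α - 1) * x) ^ N := by
    have h1 : ∀ v : Fin N → α, x ^ hammingDist w v = ∏ c, if w c ≠ v c then x else 1 := by
      intro v
      rw [hammingDist, ← Finset.prod_filter, Finset.prod_const]
    have h2 : ∀ c, ∑ a : α, (if w c ≠ a then x else 1) = 1 + (Fintype.card α - 1) * x := by
      intro c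
      rw [← Finset.add_sum_erase _ _ (Finset.mem_univ (w c))]
      rw [Finset.sum_congr rfl (g := fun _ => x) fun a ha => by
        rw [if_pos (Finset.ne_of_mem_erase ha).symm]]
      rw [Finset.sum_const, Finset.card_erase_of_mem (Finset.mem_univ _), nsmul_eq_mul,
        Finset.card_univ, Nat.cast_sub (Fintype.card_pos_iff.2 ⟨w c⟩)]
      simp
    simp_rw [h1]
    rw [← Fintype.prod_sum (fun c a => if w c ≠ a then x else (1 : ℝ))]
    rw [Finset.prod_congr rfl fun c _ => h2 c, Finset.prod_const, Finset.card_univ,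
      Fintype.card_fin]
  rw [← hsum, inv_mul_eq_div, le_div_iff₀ (by positivity)]
  calc _ = ∑ v ∈ Finset.univ.filter fun v : Fin N → α => hammingDist w v ≤ d, x ^ d := by
        rw [Finset.sum_const, nsmul_eq_mul]
    _ ≤ ∑ v ∈ Finset.univ.filter fun v : Fin N → α => hammingDist w v ≤ d,
          x ^ hammingDist w v := by
        refine Finset.sum_le_sum fun v hv => ?_
        exact pow_le_pow_of_le_one hx0.le hx1 (Finset.mem_filter.1 hv).2
    _ ≤ _ := Finset.sum_le_univ_sum_of_nonneg fun v => by positivity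

/-- The Gilbert–Varshamov bound: as long as the balls around the chosen words do not exhaust all
words, another word can be added. -/
theorem exists_code {N d : ℕ} {α : Type*} [Fintype α] [DecidableEq α] [Nonempty α] {x : ℝ}
    (hx0 : 0 < x) (hx1 : x ≤ 1) (M : ℕ)
    (hM : M * ((x ^ d)⁻¹ * (1 + (Fintype.card α - 1) * x) ^ N) < (Fintype.card α : ℝ) ^ N) :
    ∃ W : Finset (Fin N → α), M < W.card ∧ ∀ v ∈ W, ∀ w ∈ W, v ≠ w → d < hammingDist v w := by
  set V : ℝ := (x ^ d)⁻¹ * (1 + (Fintype.card α - 1) * x) ^ N with hV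
  suffices H : ∀ j ≤ M + 1, ∃ W : Finset (Fin N → α), W.card = j ∧
      ∀ v ∈ W, ∀ w ∈ W, v ≠ w → d < hammingDist v w by
    obtain ⟨W, h1, h2⟩ := H (M + 1) le_rfl
    exact ⟨W, by omega, h2⟩
  intro j
  induction j with
  | zero => exact fun _ => ⟨∅, by simp⟩
  | succ j ih =>
    intro hj
    obtain ⟨W, hW, hd⟩ := ih (by omega)
    obtain ⟨v, hv⟩ : ∃ v, v ∉ W.biUnion fun w =>
        Finset.univ.filter fun v : Fin N → α => hammingDist w v ≤ d := by
      by_contra! hc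
      have h1 : (Finset.univ : Finset (Fin N → α)).card ≤ (W.biUnion fun w =>
          Finset.univ.filter fun v : Fin N → α => hammingDist w v ≤ d).card :=
        Finset.card_le_card fun v _ => hc v
      have h2 := h1.trans Finset.card_biUnion_le
      rw [Finset.card_univ, Fintype.card_fun, Fintype.card_fin] at h2
      have h3 : ((Fintype.card α : ℝ)) ^ N ≤ ∑ w ∈ W, V := by
        have h4 := (Nat.cast_le (α := ℝ)).2 h2
        rw [Nat.cast_pow, Nat.cast_sum] at h4
        refine h4.trans ?_
        exact Finset.sum_le_sum fun w _ => card_hammingBall_le w hx0 hx1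
      rw [Finset.sum_const, hW, nsmul_eq_mul] at h3
      have hj' : (j : ℝ) ≤ M := by exact_mod_cast (by omega)
      have hV0 : 0 ≤ V := by
        have h4 : (1 : ℝ) ≤ Fintype.card α := by exact_mod_cast Fintype.card_pos
        have h5 : 0 ≤ (Fintype.card α - 1) * x := mul_nonneg (by linarith) hx0.le
        positivity
      nlinarith
    have hv' : ∀ w ∈ W, d < hammingDist w v := by
      intro w hw
      by_contra! hc
      exact hv (Finset.mem_biUnion.2 ⟨w, hw, by simpa using hc⟩)
    have hvW : v ∉ W := fun h => by simpa using hv' v h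
    refine ⟨insert v W, by rw [Finset.card_insert_of_notMem hvW, hW], ?_⟩
    intro a ha b hb hab
    rcases Finset.mem_insert.1 ha with ha' | ha' <;> rcases Finset.mem_insert.1 hb with hb' | hb'
    · exact absurd (ha'.trans hb'.symm) hab
    · rw [hammingDist_comm, ha']; exact hv' b hb'
    · rw [hb']; exact hv' a ha'
    · exact hd a ha' b hb' hab

/-! ### Vectors built from words -/

/-- The vector of a word `w` over the alphabet of signed cells.  The coordinates `e (c, p, b)` are
arranged in columns `c`, cells `p` and levels `b`; in column `c` the word chooses the cell
`(w c).1` and the sign `(w c).2`, and this cell is filled with the values `± v b`. -/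
noncomputable def wordVector {n N q B : ℕ} (e : Fin N × Fin q × Fin B ↪ Fin n) (v : ℕ → ℝ)
    (w : Fin N → Fin q × Bool) : Fin n → ℝ :=
  Function.extend e (fun p => if (w p.1).1 = p.2.1 then
    (if (w p.1).2 then v p.2.2 else -v p.2.2) else 0) 0

theorem wordVector_apply {n N q B : ℕ} (e : Fin N × Fin q × Fin B ↪ Fin n) (v : ℕ → ℝ)
    (w : Fin N → Fin q × Bool) (p : Fin N × Fin q × Fin B) :
    wordVector e v w (e p) = if (w p.1).1 = p.2.1 then
      (if (w p.1).2 then v p.2.2 else -v p.2.2) else 0 :=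
  e.injective.extend_apply _ _ p

theorem exists_of_wordVector_ne_zero {n N q B : ℕ} (e : Fin N × Fin q × Fin B ↪ Fin n)
    {v : ℕ → ℝ} {w : Fin N → Fin q × Bool} {i : Fin n} (hi : wordVector e v w i ≠ 0) :
    ∃ p, e p = i ∧ (w p.1).1 = p.2.1 ∧ |wordVector e v w i| = |v p.2.2| := by
  by_cases h : ∃ p, e p = i
  · obtain ⟨p, rfl⟩ := h
    rw [wordVector_apply] at hi ⊢
    by_cases hp : (w p.1).1 = p.2.1
    · refine ⟨p, rfl, hp, ?_⟩
      rw [if_pos hp]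
      split_ifs <;> simp
    · exact absurd (if_neg hp) hi
  · exact absurd (Function.extend_apply' _ _ _ h) hi

theorem abs_le_abs_wordVector_sub {n N q B : ℕ} (e : Fin N × Fin q × Fin B ↪ Fin n)
    (v : ℕ → ℝ) {w w' : Fin N → Fin q × Bool} {c : Fin N} (hc : w c ≠ w' c) (b : Fin B) :
    |v b| ≤ |(wordVector e v w - wordVector e v w') (e (c, (w c).1, b))| := by
  rw [Pi.sub_apply, wordVector_apply, wordVector_apply]
  dsimp only
  rw [if_pos rfl]
  by_cases h : (w' c).1 = (w c).1
  · have h2 : (w c).2 ≠ (w' c).2 := fun h2 => hc (Prod.ext h.symm h2)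
    rw [if_pos h]
    have h3 : |v b| ≤ |v b + v b| := by
      rw [← two_mul, abs_mul, abs_two]; linarith [abs_nonneg (v b)]
    have h4 : |-v b - v b| = |v b + v b| := by rw [← abs_neg]; congr 1; ring
    cases h5 : (w c).2 <;> cases h6 : (w' c).2 <;> simp_all
  · rw [if_neg h]
    split_ifs <;> simp

section

variable {n N q B m : ℕ} (e : Fin N × Fin q × Fin B ↪ Fin n) {u : ℕ → ℝ}

/-- If `u` is in the unit ball then the word vectors are bounded: the `N ≤ R * m` equal values on
level `b` are matched with the coordinates `m * b + j`, `j < m`, of `u`, which are not smaller. -/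
theorem wordVector_dominatedBy (hu : Antitone u) (hu0 : ∀ i, 0 ≤ u i) {R : ℕ} (hm : 0 < m)
    (hmB : m * B ≤ n) (hR : N ≤ R * m) (w : Fin N → Fin q × Bool) :
    DominatedBy R (wordVector e (fun b => u (m * (b + 1) - 1)) w) (fun i => u i) := by
  classical
  set z := wordVector e (fun b => u (m * (b + 1) - 1)) w with hz
  have hex : ∀ i, z i ≠ 0 → ∃ p, e p = i ∧ (w p.1).1 = p.2.1 ∧ |z i| = |u (m * (p.2.2 + 1) - 1)| :=
    fun i hi => exists_of_wordVector_ne_zero e hi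
  rcases em (∃ i, z i ≠ 0) with ⟨i, hi⟩ | hz0
  swap
  · push Not at hz0
    exact ⟨id, fun _ => 0, fun i hi => absurd (hz0 i) hi, fun i j hi => absurd (hz0 i) hi⟩
  have : Nonempty (Fin N × Fin q × Fin B) := ⟨(hex i hi).choose⟩
  choose! p hp using hex
  have hlt : ∀ i, z i ≠ 0 → m * (p i).2.2 + (p i).1 % m < n := fun i _ => by
    have h1 : (m * ((p i).2.2 + 1) : ℕ) ≤ m * B := Nat.mul_le_mul_left _ (p i).2.2.2
    have h2 := Nat.mod_lt (p i).1 hm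
    rw [mul_add] at h1
    omega
  refine ⟨fun i => if h : z i ≠ 0 then ⟨_, hlt i h⟩ else i, fun i => (p i).1 / m,
    fun i hi => ⟨?_, ?_⟩, fun i j hi hj hij hρ => ?_⟩
  · exact Nat.div_lt_of_lt_mul (by have := (p i).1.2; rw [mul_comm]; omega)
  · dsimp only
    rw [dif_pos hi, (hp i hi).2.2, abs_of_nonneg (hu0 _), abs_of_nonneg (hu0 _)]
    refine hu ?_
    have h2 := Nat.mod_lt (p i).1 hm
    rw [mul_add]
    dsimp only
    omega
  · dsimp only at hij hρ
    rw [dif_pos hi, dif_pos hj, Fin.mk.injEq] at hij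
    have h2 := Nat.mod_lt (p i).1 hm
    have h3 := Nat.mod_lt (p j).1 hm
    have hb : ((p i).2.2 : ℕ) = (p j).2.2 := by
      have := congrArg (· / m) hij
      simpa [Nat.mul_add_div hm, Nat.div_eq_of_lt h2, Nat.div_eq_of_lt h3] using this
    have hc : ((p i).1 : ℕ) = (p j).1 := by
      rw [hb] at hij
      rw [← Nat.div_add_mod (p i).1 m, ← Nat.div_add_mod (p j).1 m, hρ]
      omega
    have hc' := Fin.ext hc
    have hpp : p i = p j := by
      refine Prod.ext hc' (Prod.ext ?_ (Fin.ext hb))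
      rw [← (hp i hi).2.1, ← (hp j hj).2.1, hc']
    rw [← (hp i hi).1, ← (hp j hj).1, hpp]

/-- The difference of two word vectors dominates the coordinates `m ≤ i < hi` of `u`: these are cut
into segments of length `l`, and segment `b` is matched with the more than `d` columns in which the
words differ, on level `b`. -/
theorem dominatedBy_wordVector_sub (hu : Antitone u) (hu0 : ∀ i, 0 ≤ u i) {l R d hi : ℕ}
    (hm : 0 < m) (hml : m ≤ l) (hR : l ≤ R * (d + 1)) (hhi : hi ≤ m + l * B)
    {w w' : Fin N → Fin q × Bool} (hww : d < hammingDist w w') :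
    DominatedBy R (fun i : Fin n => if m ≤ (i : ℕ) ∧ (i : ℕ) < hi then u i else 0)
      (wordVector e (fun b => u (m * (b + 1) - 1)) w
        - wordVector e (fun b => u (m * (b + 1) - 1)) w') := by
  classical
  set D := Finset.univ.filter fun c => w c ≠ w' c with hD
  have hDcard : d + 1 ≤ D.card := hww
  set f := D.orderEmbOfFin rfl with hf
  have hD0 : 0 < D.card := by omega
  have hl : 0 < l := by omega
  let o : Fin n → ℕ := fun i => ((i : ℕ) - m) % l
  let c : Fin n → Fin N := fun i => f ⟨o i % D.card, Nat.mod_lt _ hD0⟩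
  have hc : ∀ i, w (c i) ≠ w' (c i) := fun i =>
    (Finset.mem_filter.1 (D.orderEmbOfFin_mem rfl ⟨o i % D.card, Nat.mod_lt _ hD0⟩)).2
  have hb : ∀ i : Fin n, m ≤ (i : ℕ) ∧ (i : ℕ) < hi → ((i : ℕ) - m) / l < B := fun i h =>
    Nat.div_lt_of_lt_mul (by omega)
  have hne : ∀ i : Fin n, (if m ≤ (i : ℕ) ∧ (i : ℕ) < hi then u i else 0) ≠ 0 →
      m ≤ (i : ℕ) ∧ (i : ℕ) < hi := fun i h => by
    by_contra hc; exact h (if_neg hc)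
  refine ⟨fun i => if h : m ≤ (i : ℕ) ∧ (i : ℕ) < hi then e (c i, (w (c i)).1, ⟨_, hb i h⟩) else i,
    fun i => o i / D.card, fun i h => ⟨?_, ?_⟩, fun i j h h' hij hρ => ?_⟩
  · refine Nat.div_lt_of_lt_mul ?_
    have h1 : o i < l := Nat.mod_lt _ hl
    have h2 : R * (d + 1) ≤ R * D.card := Nat.mul_le_mul_left _ hDcard
    rw [mul_comm]
    omega
  · have hi := hne i h
    dsimp only
    rw [dif_pos hi, if_pos hi]
    refine le_trans ?_ (abs_le_abs_wordVector_sub e _ (hc i) _)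
    rw [abs_of_nonneg (hu0 _), abs_of_nonneg (hu0 _)]
    refine hu ?_
    dsimp only
    have h1 : m * (((i : ℕ) - m) / l) ≤ (i : ℕ) - m :=
      (Nat.mul_le_mul_right _ hml).trans (Nat.mul_div_le _ _)
    rw [mul_add]
    omega
  · have hi := hne i h
    have hj := hne j h'
    dsimp only at hij hρ
    rw [dif_pos hi, dif_pos hj] at hij
    have h1 := e.injective hij
    simp only [Prod.mk.injEq, Fin.mk.injEq] at h1
    have h2 : o i % D.card = o j % D.card := by
      simpa using f.injective h1.1
    have h3 : o i = o j := by
      rw [← Nat.div_add_mod (o i) D.card, ← Nat.div_add_mod (o j) D.card, hρ, h2]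
    have h4 : (i : ℕ) - m = (j : ℕ) - m := by
      rw [← Nat.div_add_mod ((i : ℕ) - m) l, ← Nat.div_add_mod ((j : ℕ) - m) l, h1.2.2]
      exact congrArg _ h3
    exact Fin.ext (by omega)

end

/-- A code with more words than there are balls in a cover gives two word vectors in the same
ball, hence a lower bound for the radius. -/
theorem le_of_cover_of_code {n : ℕ} {NX NY : (Fin n → ℝ) → ℝ} {C : ℝ} (hX : IsSymmQuasiNorm NX C)
    (hY : IsSymmQuasiNorm NY C) {M : ℕ} {y : Fin M → Fin n → ℝ} {ε : ℝ}
    (hy : ∀ x, NX x ≤ 1 → ∃ i, NY (x - y i) ≤ ε) {u : ℕ → ℝ} (hu : Antitone u)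
    (hu0 : ∀ i, 0 ≤ u i) (hu1 : NX (fun i => u i) ≤ 1) {N q B m l R₁ R₂ d hi : ℕ}
    (hn : N * q * B ≤ n) (hm : 0 < m) (hmB : m * B ≤ n) (hR₁ : N ≤ R₁ * m) (hml : m ≤ l)
    (hR₂ : l ≤ R₂ * (d + 1)) (hhi : hi ≤ m + l * B) {W : Finset (Fin N → Fin q × Bool)}
    (hW : M < W.card) (hd : ∀ v ∈ W, ∀ w ∈ W, v ≠ w → d < hammingDist v w) :
    NY (fun i => if m ≤ (i : ℕ) ∧ (i : ℕ) < hi then u i else 0)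
      ≤ domConst C R₂ * (domConst C R₁ * (2 * C * ε)) := by
  classical
  obtain ⟨e⟩ : Nonempty (Fin N × Fin q × Fin B ↪ Fin n) :=
    Function.Embedding.nonempty_of_card_le (by simpa [mul_assoc] using hn)
  set z := wordVector e (fun b => u (m * (b + 1) - 1)) with hz
  set K := domConst C R₁ with hK
  have hK0 : 0 < K := domConst_pos hX.one_le _
  have hball : ∀ w, NX (K⁻¹ • z w) ≤ 1 := by
    intro w
    have h1 := hX.le_of_dominatedBy (wordVector_dominatedBy e hu hu0 hm hmB hR₁ w)
    rw [hX.smul, abs_of_pos (by positivity), inv_mul_le_iff₀ hK0, mul_one]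
    exact h1.trans (mul_le_of_le_one_right hK0.le hu1)
  choose g hg using fun w => hy _ (hball w)
  obtain ⟨w, hw, w', hw', hne, hgg⟩ := Finset.exists_ne_map_eq_of_card_lt_of_maps_to
    (s := W) (t := Finset.univ) (f := g) (by simpa using hW) fun _ _ => Finset.mem_univ _
  have h1 := hY.le_of_dominatedBy
    (dominatedBy_wordVector_sub e hu hu0 hm hml hR₂ hhi (hd w hw w' hw' hne))
  have h2 : NY (z w - z w') ≤ K * (2 * C * ε) := by
    have e1 : z w - z w' = K • ((K⁻¹ • z w - y (g w)) + (-1 : ℝ) • (K⁻¹ • z w' - y (g w'))) := by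
      rw [hgg]
      have : K • K⁻¹ • (z w - z w') = z w - z w' := by
        rw [smul_smul, mul_inv_cancel₀ hK0.ne', one_smul]
      rw [← this]
      congr 1
      rw [smul_sub, neg_one_smul]
      abel
    rw [e1, hY.smul, abs_of_pos hK0]
    refine mul_le_mul_of_nonneg_left ((hY.add_le _ _).trans ?_) hK0.le
    rw [hY.smul, abs_neg, abs_one, one_mul]
    have := mul_le_mul_of_nonneg_left (add_le_add (hg w) (hg w')) hY.pos.le
    linarith
  exact h1.trans (mul_le_mul_of_nonneg_left h2 (domConst_pos hX.one_le _).le)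

/-! ### Tails and covers of the unit ball -/

section

variable {n : ℕ} {NX NY : (Fin n → ℝ) → ℝ} {C : ℝ} {k s : ℕ}
  {y : Fin (2 ^ (k - 1)) → Fin n → ℝ} {ε : ℝ} {u : ℕ → ℝ}

/-- The Gilbert–Varshamov condition for binary words of length `2 * k` and distance `k / 5`. -/
theorem eight_pow_div_five_mul_lt (hk : 1 ≤ k) :
    ((2 ^ (k - 1) : ℕ) : ℝ) * ((((1 / 8 : ℝ)) ^ (k / 5))⁻¹
      * (1 + ((Fintype.card (Fin 1 × Bool) : ℝ) - 1) * (1 / 8)) ^ (2 * k))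
      < (Fintype.card (Fin 1 × Bool) : ℝ) ^ (2 * k) := by
  have h1 : (8 : ℝ) ^ (k / 5) * (81 / 128) ^ k ≤ 1 := by
    have h2 : ((8 : ℝ) ^ (k / 5) * (81 / 128) ^ k) ^ 5 ≤ 1 := by
      calc ((8 : ℝ) ^ (k / 5) * (81 / 128) ^ k) ^ 5
          = 8 ^ (k / 5 * 5) * ((81 / 128) ^ 5) ^ k := by
            rw [mul_pow, ← pow_mul, ← pow_mul, ← pow_mul, mul_comm k 5]
        _ ≤ 8 ^ k * ((81 / 128) ^ 5) ^ k := by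
            gcongr
            · norm_num
            · omega
        _ = (8 * (81 / 128) ^ 5) ^ k := (mul_pow _ _ _).symm
        _ ≤ 1 := pow_le_one₀ (by norm_num) (by norm_num)
    by_contra! hc
    exact absurd (one_lt_pow₀ hc (by norm_num : (5 : ℕ) ≠ 0)) (not_lt.2 h2)
  have hcard : (Fintype.card (Fin 1 × Bool) : ℝ) = 2 := by simp
  have e : ((2 ^ k : ℕ) : ℝ) = 2 * ((2 ^ (k - 1) : ℕ) : ℝ) := by
    have : 2 ^ k = 2 * 2 ^ (k - 1) := by rw [← pow_succ', Nat.sub_add_cancel hk]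
    exact_mod_cast this
  have hp : (0 : ℝ) < (2 ^ k : ℕ) := by positivity
  rw [hcard, one_div, inv_pow, inv_inv]
  have h3 : (2 : ℝ) ^ (2 * k) = (2 ^ k : ℕ) * 2 ^ k := by push_cast; rw [two_mul, pow_add]
  have h4 : (1 + (2 - 1) * (8 : ℝ)⁻¹) ^ (2 * k) = (81 / 128) ^ k * 2 ^ k := by
    rw [pow_mul, ← mul_pow]; norm_num
  rw [h3, h4, ← mul_assoc (8 ^ (k / 5) : ℝ), ← mul_assoc]
  refine mul_lt_mul_of_pos_right ?_ (by positivity)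
  have := mul_le_mul_of_nonneg_left h1 (show (0 : ℝ) ≤ (2 ^ (k - 1) : ℕ) by positivity)
  linarith

/-- The coordinates from `m` on are controlled by sign patterns alone: the code consists of `± 1`
words of length `2 * k`, which are repeated on consecutive blocks of coordinates. -/
theorem tail_le_of_cover (hX : IsSymmQuasiNorm NX C) (hY : IsSymmQuasiNorm NY C)
    (hy : ∀ x, NX x ≤ 1 → ∃ i, NY (x - y i) ≤ ε) (hu : Antitone u)
    (hu0 : ∀ i, 0 ≤ u i) (hu1 : NX (fun i => u i) ≤ 1) (hk : 1 ≤ k) (hkn : 2 * k < n) {m : ℕ}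
    (hmk : m ≤ k) (hkm : k ≤ 5 * m) :
    NY (fun i => if m ≤ (i : ℕ) ∧ (i : ℕ) < n then u i else 0)
      ≤ domConst C 20 * (domConst C 10 * (2 * C * ε)) := by
  obtain ⟨W, hW, hd⟩ := exists_code (α := Fin 1 × Bool) (by norm_num) (by norm_num) _
    (eight_pow_div_five_mul_lt hk)
  have h1 : 2 * k * (n / (2 * k)) ≤ n := Nat.mul_div_le _ _
  have h2 : n < 2 * k * (n / (2 * k)) + 2 * k := Nat.lt_mul_div_succ n (by omega)
  have h3 : 1 ≤ n / (2 * k) := Nat.div_pos hkn.le (by omega)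
  have h4 : 2 * k * 1 ≤ 2 * k * (n / (2 * k)) := Nat.mul_le_mul_left _ h3
  have h5 : 4 * k * (n / (2 * k)) = 2 * (2 * k * (n / (2 * k))) := by ring
  have h6 : m * (n / (2 * k)) ≤ 2 * k * (n / (2 * k)) := Nat.mul_le_mul_right _ (by omega)
  exact le_of_cover_of_code hX hY hy hu hu0 hu1 (N := 2 * k) (q := 1) (B := n / (2 * k)) (m := m)
    (l := 4 * k) (R₁ := 10) (R₂ := 20) (d := k / 5) (hi := n)
    (by rwa [mul_one]) (by omega) (by omega) (by omega) (by omega) (by omega) (by omega) hW hd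

/-- The Gilbert–Varshamov condition for words of length `4 * s` and distance `s` over an alphabet
of `Q` letters, where `Q` is about `n / (2 * k)`; it uses `2 ^ k < (n / k + 1) ^ s`. -/
theorem two_pow_mul_card_pow_lt (hk : 1 ≤ k) (hkn : 64 * k ≤ n)
    (hL : (k : ℝ) < s * Real.log ((n : ℝ) / k + 1)) {Q : ℝ} (hQ : Q = 2 * ((n / (4 * k) : ℕ) : ℝ)) :
    ((2 ^ (k - 1) : ℕ) : ℝ) * ((((1 / Q : ℝ)) ^ (s - 1))⁻¹ * (1 + (Q - 1) * (1 / Q)) ^ (4 * s))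
      < Q ^ (4 * s) := by
  have hk0 : (0 : ℝ) < k := by exact_mod_cast hk
  set r : ℝ := (n : ℝ) / k with hr
  have hr64 : 64 ≤ r := by
    rw [hr, le_div_iff₀ hk0]; exact_mod_cast hkn
  have hQr : r / 2 - 2 ≤ Q := by
    have h1 : n < 4 * k * (n / (4 * k)) + 4 * k := Nat.lt_mul_div_succ n (by omega)
    have h2 : (n : ℝ) < 4 * k * ((n / (4 * k) : ℕ) : ℝ) + 4 * k := by exact_mod_cast h1
    have h3 : r < 4 * ((n / (4 * k) : ℕ) : ℝ) + 4 := by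
      rw [hr, div_lt_iff₀ hk0]; nlinarith
    rw [hQ]; linarith
  have hQ30 : 30 ≤ Q := by linarith
  have hQ0 : 0 < Q := by linarith
  have h2k : (2 : ℝ) ^ (k - 1) < (r + 1) ^ s := by
    have h1 : (2 : ℝ) ^ (k - 1) ≤ 2 ^ k := pow_le_pow_right₀ one_le_two (Nat.sub_le _ _)
    have h2 : (2 : ℝ) ^ k ≤ Real.exp 1 ^ k :=
      pow_le_pow_left₀ (by norm_num) (by linarith [Real.add_one_le_exp (1 : ℝ)]) _
    have h3 : Real.exp 1 ^ k < (r + 1) ^ s := by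
      rw [← Real.exp_nat_mul, mul_one]
      rw [← Real.exp_log (show (0 : ℝ) < r + 1 by linarith), ← Real.exp_nat_mul]
      exact Real.exp_lt_exp.2 hL
    linarith
  have hcub : (r + 1) * 16 ≤ Q ^ 3 := by nlinarith [mul_self_nonneg (Q - 30), sq_nonneg Q]
  have hle : (1 + (Q - 1) * (1 / Q)) ^ (4 * s) ≤ 16 ^ s := by
    rw [pow_mul]
    refine pow_le_pow_left₀ ?_ ?_ _
    · positivity
    · have : 1 + (Q - 1) * (1 / Q) ≤ 2 := by
        rw [mul_one_div, sub_div, div_self hQ0.ne']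
        have : 0 ≤ 1 / Q := by positivity
        linarith
      have h0 : 0 ≤ 1 + (Q - 1) * (1 / Q) := by
        have : 0 ≤ (Q - 1) * (1 / Q) := mul_nonneg (by linarith) (by positivity)
        linarith
      calc (1 + (Q - 1) * (1 / Q)) ^ 4 ≤ 2 ^ 4 := pow_le_pow_left₀ h0 this _
        _ = 16 := by norm_num
  rw [one_div, inv_pow, inv_inv]
  rw [one_div] at hle
  calc ((2 ^ (k - 1) : ℕ) : ℝ) * (Q ^ (s - 1) * (1 + (Q - 1) * Q⁻¹) ^ (4 * s))
      ≤ ((2 ^ (k - 1) : ℕ) : ℝ) * (Q ^ s * 16 ^ s) := by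
        refine mul_le_mul_of_nonneg_left (mul_le_mul (pow_le_pow_right₀ (by linarith)
          (Nat.sub_le _ _)) hle (pow_nonneg ?_ _) (by positivity)) (by positivity)
        exact add_nonneg zero_le_one (mul_nonneg (by linarith) (by positivity))
    _ < (r + 1) ^ s * (Q ^ s * 16 ^ s) := by
        push_cast
        exact mul_lt_mul_of_pos_right h2k (by positivity)
    _ = ((r + 1) * 16 * Q) ^ s := by rw [mul_pow, mul_pow]; ring
    _ ≤ (Q ^ 3 * Q) ^ s := by
        refine pow_le_pow_left₀ (by positivity) ?_ _
        gcongr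
    _ = Q ^ (4 * s) := by rw [pow_mul]; ring

/-- The coordinates between `s` and `k` are controlled by the choice of supports: the code consists
of words of length `4 * s` over an alphabet with about `n / k` letters. -/
theorem segment_le_of_cover (hX : IsSymmQuasiNorm NX C) (hY : IsSymmQuasiNorm NY C)
    (hy : ∀ x, NX x ≤ 1 → ∃ i, NY (x - y i) ≤ ε) (hu : Antitone u)
    (hu0 : ∀ i, 0 ≤ u i) (hu1 : NX (fun i => u i) ≤ 1) (hk : 1 ≤ k) (hkn : 64 * k ≤ n)
    (hs : 1 ≤ s) (hsk : s ≤ k) (hL : (k : ℝ) < s * Real.log ((n : ℝ) / k + 1)) :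
    NY (fun i => if s ≤ (i : ℕ) ∧ (i : ℕ) < k then u i else 0)
      ≤ domConst C 1 * (domConst C 4 * (2 * C * ε)) := by
  have h3 : 16 ≤ n / (4 * k) := (Nat.le_div_iff_mul_le (by omega)).2 (by omega)
  have : Nonempty (Fin (n / (4 * k)) × Bool) := ⟨(⟨0, by omega⟩, true)⟩
  have hQ : (Fintype.card (Fin (n / (4 * k)) × Bool) : ℝ) = 2 * ((n / (4 * k) : ℕ) : ℝ) := by
    rw [Fintype.card_prod, Fintype.card_fin, Fintype.card_bool]; push_cast; ring
  have h3' : (16 : ℝ) ≤ ((n / (4 * k) : ℕ) : ℝ) := by exact_mod_cast h3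
  obtain ⟨W, hW, hd⟩ := exists_code (α := Fin (n / (4 * k)) × Bool) (N := 4 * s) (d := s - 1)
    (x := 1 / (Fintype.card (Fin (n / (4 * k)) × Bool) : ℝ)) (by rw [hQ]; positivity)
    (by rw [hQ, div_le_one (by positivity)]; linarith) _ (two_pow_mul_card_pow_lt hk hkn hL hQ)
  have h1 : s * (k / s) ≤ k := Nat.mul_div_le _ _
  have h2 : k < s * (k / s) + s := Nat.lt_mul_div_succ k (by omega)
  have h4 : 4 * k * (n / (4 * k)) ≤ n := Nat.mul_div_le _ _
  have h5 : 4 * s * (n / (4 * k)) * (k / s) ≤ n := by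
    calc 4 * s * (n / (4 * k)) * (k / s) = 4 * (s * (k / s)) * (n / (4 * k)) := by ring
      _ ≤ 4 * k * (n / (4 * k)) := by gcongr
      _ ≤ n := h4
  exact le_of_cover_of_code hX hY hy hu hu0 hu1 (N := 4 * s) (q := n / (4 * k)) (B := k / s)
    (m := s) (l := s) (R₁ := 4) (R₂ := 1) (d := s - 1) (hi := k)
    h5 (by omega) (by omega) (by omega) (by omega) (by omega) (by omega) hW hd

/-- The constant in the lower estimate of the entropy numbers. -/
noncomputable def lowerConst (C : ℝ) : ℝ :=
  C * (domConst C 1 * (domConst C 4 * (2 * C)) + domConst C 20 * (domConst C 10 * (2 * C)))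

theorem lowerConst_pos (hC : 1 ≤ C) : 0 < lowerConst C := by
  have h0 : 0 < C := by linarith
  have h := domConst_pos hC
  have := h 1; have := h 4; have := h 20; have := h 10
  unfold lowerConst; positivity

/-- A cover of the unit ball of `NX` by `2 ^ (k - 1)` balls of radius `ε` in `NY` controls the tails
after `s` of all non-increasing vectors in the unit ball. -/
theorem sorted_tail_le_of_cover (hX : IsSymmQuasiNorm NX C) (hY : IsSymmQuasiNorm NY C)
    (hε : 0 < ε) (hy : ∀ x, NX x ≤ 1 → ∃ i, NY (x - y i) ≤ ε) (hu : Antitone u)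
    (hu0 : ∀ i, 0 ≤ u i) (hu1 : NX (fun i => u i) ≤ 1) (hk : 1 ≤ k) (hkn : 2 * k < n)
    (hs : 1 ≤ s) (hsk : s ≤ k) (hL : (k : ℝ) < s * Real.log ((n : ℝ) / k + 1)) :
    NY (fun i => if s ≤ (i : ℕ) then u i else 0) ≤ lowerConst C * ε := by
  have hC := hX.pos
  have h1 := hX.one_le
  have hd := domConst_pos hX.one_le
  have hd1 := hd 1; have hd4 := hd 4; have hd20 := hd 20; have hd10 := hd 10
  have hk0 : (0 : ℝ) < k := by exact_mod_cast hk
  -- for bounded `n / k` the numbers `s` and `k` are comparable, and sign patterns suffice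
  rcases lt_or_ge n (64 * k) with hn | hn
  · have hks : k ≤ 5 * s := by
      have h2 : Real.log ((n : ℝ) / k + 1) ≤ 5 := by
        rw [Real.log_le_iff_le_exp (by positivity)]
        have h3 : (n : ℝ) / k ≤ 64 := by
          rw [div_le_iff₀ hk0]; exact_mod_cast hn.le
        have h4 : (2.7 : ℝ) ^ 5 ≤ Real.exp 1 ^ 5 :=
          pow_le_pow_left₀ (by norm_num) (by linarith [Real.exp_one_gt_d9]) _
        rw [← Real.exp_nat_mul] at h4
        norm_num at h4
        linarith
      have h3 : (k : ℝ) ≤ 5 * s := by nlinarith [(Nat.cast_nonneg s : (0 : ℝ) ≤ s)]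
      exact_mod_cast h3
    have h2 := tail_le_of_cover hX hY hy hu hu0 hu1 hk hkn hsk hks
    simp only [Fin.is_lt, and_true] at h2
    refine h2.trans ?_
    have e : domConst C 20 * (domConst C 10 * (2 * C * ε))
      = domConst C 20 * (domConst C 10 * (2 * C)) * ε := by ring
    rw [e]
    refine mul_le_mul_of_nonneg_right ?_ hε.le
    have h3 : 0 ≤ domConst C 1 * (domConst C 4 * (2 * C)) := by positivity
    have h4 : 0 ≤ domConst C 20 * (domConst C 10 * (2 * C)) := by positivity
    unfold lowerConst
    nlinarith
  · have h2 := tail_le_of_cover hX hY hy hu hu0 hu1 hk hkn le_rfl (by omega : k ≤ 5 * k)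
    have h3 := segment_le_of_cover hX hY hy hu hu0 hu1 hk hn hs hsk hL
    have e : (fun i : Fin n => if s ≤ (i : ℕ) then u i else 0)
        = (fun i : Fin n => if s ≤ (i : ℕ) ∧ (i : ℕ) < k then u i else 0)
          + fun i : Fin n => if k ≤ (i : ℕ) ∧ (i : ℕ) < n then u i else 0 := by
      funext i
      have := i.2
      simp only [Pi.add_apply]
      split_ifs <;> first | omega | simp
    rw [e]
    refine (hY.add_le _ _).trans ?_
    calc _ ≤ C * (domConst C 1 * (domConst C 4 * (2 * C * ε))
          + domConst C 20 * (domConst C 10 * (2 * C * ε))) := by gcongr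
      _ = _ := by unfold lowerConst; ring

end

/-! ### Counting sparse integer vectors -/

theorem sum_Icc_weight_le {x : ℝ} (hx : 0 ≤ x) (M : ℕ) :
    ∑ a ∈ Finset.Icc (-(M : ℤ)) M, (if a = 0 then (1 : ℝ) else x) / (1 + |(a : ℝ)|) ^ 2
      ≤ 1 + 2 * x * (1 - 1 / (M + 1)) := by
  induction M with
  | zero => simp
  | succ M ih =>
    have e : Finset.Icc (-((M + 1 : ℕ) : ℤ)) ((M + 1 : ℕ) : ℤ)
        = insert (-((M + 1 : ℕ) : ℤ)) (insert ((M + 1 : ℕ) : ℤ) (Finset.Icc (-(M : ℤ)) M)) := by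
      ext a
      simp only [Finset.mem_insert, Finset.mem_Icc]
      push_cast
      omega
    have h0 : ((M + 1 : ℕ) : ℤ) ≠ 0 := by positivity
    have h1 : |(((M + 1 : ℕ) : ℤ) : ℝ)| = M + 1 := by
      rw [abs_of_nonneg (by positivity)]; push_cast; ring
    rw [e, Finset.sum_insert (by simp only [Finset.mem_insert, Finset.mem_Icc]; push_cast; omega),
      Finset.sum_insert (by simp only [Finset.mem_Icc]; push_cast; omega),
      if_neg (neg_ne_zero.2 h0), if_neg h0, Int.cast_neg, abs_neg, h1]
    have h2 : x / (1 + ((M : ℝ) + 1)) ^ 2 ≤ x * (1 / (M + 1) - 1 / (M + 1 + 1)) := by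
      rw [div_eq_mul_one_div]
      refine mul_le_mul_of_nonneg_left ?_ hx
      rw [div_sub_div _ _ (by positivity) (by positivity), div_le_div_iff₀ (by positivity)
        (by positivity)]
      nlinarith [(Nat.cast_nonneg M : (0 : ℝ) ≤ M)]
    push_cast
    linarith

/-- The number of integer vectors with at most `t` nonzero coordinates and with
`∏ (1 + |z i|) ≤ P`, estimated by the weights `∏ x ^ [z i ≠ 0] / (1 + |z i|) ^ 2`. -/
theorem exists_finset_sparse (n t : ℕ) {P x : ℝ} (hx0 : 0 < x) (hx1 : x ≤ 1) :
    ∃ Z : Finset (Fin n → ℤ), (∀ z : Fin n → ℤ,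
        (Finset.univ.filter fun i => z i ≠ 0).card ≤ t → ∏ i, (1 + |(z i : ℝ)|) ≤ P → z ∈ Z) ∧
      (Z.card : ℝ) ≤ (x ^ t)⁻¹ * P ^ 2 * (1 + 2 * x) ^ n := by
  classical
  set M := ⌊P⌋₊
  set S := Fintype.piFinset fun _ : Fin n => Finset.Icc (-(M : ℤ)) M with hS
  let g : ℤ → ℝ := fun a => (if a = 0 then (1 : ℝ) else x) / (1 + |(a : ℝ)|) ^ 2
  have hg0 : ∀ a, 0 ≤ g a := fun a => by
    simp only [g]; split_ifs <;> positivity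
  refine ⟨S.filter fun z => (Finset.univ.filter fun i => z i ≠ 0).card ≤ t ∧
    ∏ i, (1 + |(z i : ℝ)|) ≤ P, fun z hz hP => ?_, ?_⟩
  · refine Finset.mem_filter.2 ⟨Fintype.mem_piFinset.2 fun i => ?_, hz, hP⟩
    have h1 : 1 + |(z i : ℝ)| ≤ P := by
      refine le_trans ?_ hP
      rw [← Finset.mul_prod_erase _ _ (Finset.mem_univ i)]
      refine le_mul_of_one_le_right (by positivity) ?_
      refine le_of_eq_of_le (Finset.prod_const_one (s := Finset.univ.erase i)).symm
        (Finset.prod_le_prod (fun j _ => zero_le_one) fun j _ => ?_)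
      linarith [abs_nonneg (z j : ℝ)]
    have h2 : (z i).natAbs ≤ M := Nat.le_floor (by
      rw [Nat.cast_natAbs, Int.cast_abs]; linarith)
    rw [Finset.mem_Icc]
    omega
  · have hsum : ∑ z ∈ S, ∏ i, g (z i) ≤ (1 + 2 * x) ^ n := by
      rw [hS, ← Finset.prod_univ_sum (fun _ : Fin n => Finset.Icc (-(M : ℤ)) M) fun _ a => g a,
        Finset.prod_const, Finset.card_univ, Fintype.card_fin]
      refine pow_le_pow_left₀ (Finset.sum_nonneg fun a _ => hg0 a) ?_ _
      refine (sum_Icc_weight_le hx0.le M).trans ?_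
      have : 0 ≤ 1 / ((M : ℝ) + 1) := by positivity
      nlinarith
    have hone : ∀ z ∈ S.filter fun z => (Finset.univ.filter fun i => z i ≠ 0).card ≤ t ∧
        ∏ i, (1 + |(z i : ℝ)|) ≤ P, 1 ≤ (x ^ t)⁻¹ * P ^ 2 * ∏ i, g (z i) := by
      intro z hz
      obtain ⟨-, h1, h2⟩ := Finset.mem_filter.1 hz
      have e : ∏ i, g (z i) = x ^ (Finset.univ.filter fun i => z i ≠ 0).card
          / (∏ i, (1 + |(z i : ℝ)|)) ^ 2 := by
        simp only [g]
        rw [Finset.prod_div_distrib, Finset.prod_pow]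
        congr 1
        rw [← Finset.prod_const, Finset.prod_filter]
        exact Finset.prod_congr rfl fun i _ => by by_cases h : z i = 0 <;> simp [h]
      have hpos : 0 < ∏ i, (1 + |(z i : ℝ)|) := Finset.prod_pos fun i _ => by positivity
      rw [e, mul_div_assoc', one_le_div (by positivity)]
      have h3 : x ^ t ≤ x ^ (Finset.univ.filter fun i => z i ≠ 0).card :=
        pow_le_pow_of_le_one hx0.le hx1 h1
      have h4 : (∏ i, (1 + |(z i : ℝ)|)) ^ 2 ≤ P ^ 2 := pow_le_pow_left₀ hpos.le h2 2
      have hxt : 0 < x ^ t := by positivity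
      calc (∏ i, (1 + |(z i : ℝ)|)) ^ 2 ≤ P ^ 2 := h4
        _ = (x ^ t)⁻¹ * P ^ 2 * x ^ t := by field_simp
        _ ≤ _ := mul_le_mul_of_nonneg_left h3 (by positivity)
    have h0 : 0 ≤ (x ^ t)⁻¹ * P ^ 2 := by positivity
    calc _ ≤ ∑ z ∈ S.filter fun z => (Finset.univ.filter fun i => z i ≠ 0).card ≤ t ∧
          ∏ i, (1 + |(z i : ℝ)|) ≤ P, (x ^ t)⁻¹ * P ^ 2 * ∏ i, g (z i) := by
          rw [Finset.card_eq_sum_ones, Nat.cast_sum, Nat.cast_one]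
          exact Finset.sum_le_sum hone
      _ ≤ ∑ z ∈ S, (x ^ t)⁻¹ * P ^ 2 * ∏ i, g (z i) :=
          Finset.sum_le_sum_of_subset_of_nonneg (Finset.filter_subset _ _) fun z _ _ =>
            mul_nonneg h0 (Finset.prod_nonneg fun i _ => hg0 _)
      _ ≤ _ := by
          rw [← Finset.mul_sum]
          exact mul_le_mul_of_nonneg_left hsum h0

/-- The exponent of the polynomial growth of `domConst C R` in `R`. -/
noncomputable def growthExp (C : ℝ) : ℕ := ⌈2 * C⌉₊

theorem domConst_le {C : ℝ} (hC : 1 ≤ C) {R : ℕ} (hR : 1 ≤ R) :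
    domConst C R ≤ latticeConst C * (2 * R : ℝ) ^ growthExp C := by
  have h1 : 2 * C ≤ 2 ^ growthExp C := by
    refine (Nat.le_ceil _).trans ?_
    exact_mod_cast (Nat.lt_two_pow_self (n := ⌈2 * C⌉₊)).le
  have h2 : 2 ^ Nat.clog 2 R ≤ 2 * R := by
    rcases hR.eq_or_lt with rfl | hR
    · simp
    · have h3 := Nat.pow_pred_clog_lt_self one_lt_two hR
      have h4 : 0 < Nat.clog 2 R := Nat.clog_pos one_lt_two hR
      rw [← Nat.succ_pred_eq_of_pos h4, pow_succ]
      omega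
  unfold domConst
  refine mul_le_mul_of_nonneg_left ?_ (latticeConst_pos hC).le
  calc (2 * C) ^ Nat.clog 2 R ≤ ((2 : ℝ) ^ growthExp C) ^ Nat.clog 2 R :=
        pow_le_pow_left₀ (by linarith) h1 _
    _ = ((2 : ℝ) ^ Nat.clog 2 R) ^ growthExp C := by rw [← pow_mul, ← pow_mul, mul_comm]
    _ ≤ (2 * R : ℝ) ^ growthExp C :=
        pow_le_pow_left₀ (by positivity) (by exact_mod_cast h2) _

/-- Rounding towards zero. -/
theorem exists_int_abs_le (r : ℝ) : ∃ m : ℤ, |(m : ℝ)| ≤ |r| ∧ |r - m| ≤ 1 := by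
  rcases le_total 0 r with h | h
  · refine ⟨⌊r⌋, ?_, ?_⟩
    · rw [abs_of_nonneg h, abs_of_nonneg (by exact_mod_cast Int.floor_nonneg.2 h)]
      exact Int.floor_le r
    · rw [abs_le]; constructor <;> linarith [Int.floor_le r, Int.lt_floor_add_one r]
  · refine ⟨⌈r⌉, ?_, ?_⟩
    · rw [abs_of_nonpos h, abs_of_nonpos (by exact_mod_cast Int.ceil_nonpos.2 h)]
      linarith [Int.le_ceil r]
    · rw [abs_le]; constructor <;> linarith [Int.le_ceil r, Int.ceil_lt_add_one r]

/-! ### Approximation by lattice points -/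

section

variable {n : ℕ} {NX NY : (Fin n → ℝ) → ℝ} {C σ : ℝ} {s A : ℕ}

theorem tail_le_mul (hX : IsSymmQuasiNorm NX C) (hY : IsSymmQuasiNorm NY C)
    (hσ : ∀ a : ℕ → ℝ, Antitone a → (∀ i, 0 ≤ a i) → NX (fun i => a i) ≤ 1 →
      NY (fun i => if s ≤ (i : ℕ) then a i else 0) ≤ σ)
    {a : ℕ → ℝ} (ha : Antitone a) (ha0 : ∀ i, 0 ≤ a i) {r : ℝ} (hr : 0 < r)
    (har : NX (fun i => a i) ≤ r) :
    NY (fun i => if s ≤ (i : ℕ) then a i else 0) ≤ r * σ := by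
  have h := hσ (fun i => r⁻¹ * a i)
    (fun i j hij => mul_le_mul_of_nonneg_left (ha hij) (by positivity))
    (fun i => mul_nonneg (by positivity) (ha0 i)) (by
      have e : (fun i : Fin n => r⁻¹ * a i) = r⁻¹ • fun i : Fin n => a i := rfl
      rw [e, hX.smul, abs_of_pos (by positivity), inv_mul_le_iff₀ hr, mul_one]
      exact har)
  have e : (fun i : Fin n => if s ≤ (i : ℕ) then a i else 0)
      = r • fun i : Fin n => if s ≤ (i : ℕ) then r⁻¹ * a i else 0 := by
    funext i
    simp only [Pi.smul_apply, smul_eq_mul, mul_ite, mul_zero]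
    rw [mul_inv_cancel_left₀ hr.ne']
  rw [e, hY.smul, abs_of_pos hr]
  exact mul_le_mul_of_nonneg_left h hr.le

/-- The tail after the `s / A` largest coordinates is still controlled by `σ`: repeating each
coordinate `A + 1` times moves it beyond the first `s` coordinates. -/
theorem shorter_tail_le (hX : IsSymmQuasiNorm NX C) (hY : IsSymmQuasiNorm NY C)
    (hσ : ∀ a : ℕ → ℝ, Antitone a → (∀ i, 0 ≤ a i) → NX (fun i => a i) ≤ 1 →
      NY (fun i => if s ≤ (i : ℕ) then a i else 0) ≤ σ)
    (hs : 2 * s < n) (hA : 1 ≤ A) {x : Fin n → ℝ} (hx : NX x ≤ 1) {u : ℕ → ℝ}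
    {π : Equiv.Perm (Fin n)} (hu : Antitone u) (hu0 : ∀ i, 0 ≤ u i) (hxu : ∀ i, |x i| = u (π i)) :
    NY (fun i => if s / A ≤ (π i : ℕ) then x i else 0)
      ≤ domConst C 2 * (domConst C (A + 1) * σ) := by
  have hux : NX (fun i => u i) ≤ 1 := by
    refine le_of_eq_of_le (hX.symm x _ π fun i => ?_).symm hx
    rw [hxu, abs_of_nonneg (hu0 _)]
  have hD := domConst_pos hX.one_le
  have hsA : s < A * (s / A) + A := Nat.lt_mul_div_succ s (by omega)
  have h1 : DominatedBy (A + 1) (fun i : Fin n => u ((i : ℕ) / (A + 1))) (fun i => u i) := by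
    refine ⟨fun i => ⟨(i : ℕ) / (A + 1), (Nat.div_le_self _ _).trans_lt i.2⟩,
      fun i => (i : ℕ) % (A + 1), fun i _ => ⟨Nat.mod_lt _ (by omega), le_rfl⟩,
      fun i j _ _ hij hρ => ?_⟩
    rw [Fin.mk.injEq] at hij
    refine Fin.ext ?_
    rw [← Nat.div_add_mod (i : ℕ) (A + 1), ← Nat.div_add_mod (j : ℕ) (A + 1), hij]
    exact congrArg _ hρ
  have h2 := tail_le_mul hX hY hσ (a := fun j => u (j / (A + 1)))
    (fun i j hij => hu (Nat.div_le_div_right hij)) (fun i => hu0 _) (hD (A + 1))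
    ((hX.le_of_dominatedBy h1).trans (mul_le_of_le_one_right (hD _).le hux))
  refine (hY.le_of_dominatedBy ?_).trans (mul_le_mul_of_nonneg_left h2 (hD 2).le)
  have hns : 0 < n - s := by omega
  refine ⟨fun i => ⟨s + (π i : ℕ) % (n - s), by have := Nat.mod_lt (π i : ℕ) hns; omega⟩,
    fun i => (π i : ℕ) / (n - s), fun i hi => ⟨?_, ?_⟩, fun i j _ _ hij hρ => ?_⟩
  · refine Nat.div_lt_of_lt_mul ?_
    have := (π i).2
    omega
  · have ht : s / A ≤ (π i : ℕ) := by by_contra hc; exact hi (if_neg hc)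
    dsimp only
    rw [if_pos ht, if_pos (Nat.le_add_right _ _), hxu, abs_of_nonneg (hu0 _)]
    refine hu (Nat.le_of_lt_succ (Nat.div_lt_of_lt_mul ?_))
    have h3 := Nat.mod_le (π i : ℕ) (n - s)
    have h4 : A * (s / A) ≤ A * (π i : ℕ) := Nat.mul_le_mul_left _ ht
    have h5 : (A + 1) * ((π i : ℕ) + 1) = A * (π i : ℕ) + A + (π i : ℕ) + 1 := by ring
    rw [Nat.succ_eq_add_one, h5]
    omega
  · rw [Fin.mk.injEq] at hij
    refine π.injective (Fin.ext ?_)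
    rw [← Nat.div_add_mod (π i : ℕ) (n - s), ← Nat.div_add_mod (π j : ℕ) (n - s),
      Nat.add_left_cancel hij]
    exact congrArg (fun m => (n - s) * m + _) hρ

/-- The coordinates of a vector in the unit ball, by comparison with the flat vectors
`u i * 1_[0, 2 * s)`, whose multiplicity with respect to `u` is about `2 * s / (i + 1)`. -/
theorem coord_mul_le (hX : IsSymmQuasiNorm NX C) (hY : IsSymmQuasiNorm NY C) (hσ0 : 0 < σ)
    (hσ : ∀ a : ℕ → ℝ, Antitone a → (∀ i, 0 ≤ a i) → NX (fun i => a i) ≤ 1 →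
      NY (fun i => if s ≤ (i : ℕ) then a i else 0) ≤ σ)
    {u : ℕ → ℝ} (hu : Antitone u) (hu0 : ∀ i, 0 ≤ u i) (hux : NX (fun i => u i) ≤ 1) {i : ℕ}
    (his : i < s) (hs : 2 * s < n) :
    u i * NY (fun j => if s ≤ (j : ℕ) ∧ (j : ℕ) < 2 * s then 1 else 0)
      ≤ latticeConst C * (6 * s / (i + 1) : ℝ) ^ growthExp C * σ := by
  set R := 2 * s / (i + 1) + 1
  have hD := domConst_pos hX.one_le
  have h1 : DominatedBy R (fun j : Fin n => if (j : ℕ) < 2 * s then u i else 0)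
      (fun j => u j) := by
    refine ⟨fun j => ⟨(j : ℕ) % (i + 1), (Nat.mod_lt _ (by omega)).trans_le (by omega)⟩,
      fun j => (j : ℕ) / (i + 1), fun j hj => ⟨?_, ?_⟩, fun j l _ _ hij hρ => ?_⟩
    · have hj' : (j : ℕ) < 2 * s := by by_contra hc; exact hj (if_neg hc)
      exact Nat.lt_succ_of_le (Nat.div_le_div_right hj'.le)
    · have hj' : (j : ℕ) < 2 * s := by by_contra hc; exact hj (if_neg hc)
      dsimp only
      rw [if_pos hj', abs_of_nonneg (hu0 _), abs_of_nonneg (hu0 _)]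
      exact hu (Nat.le_of_lt_succ (Nat.mod_lt _ (by omega)))
    · rw [Fin.mk.injEq] at hij
      refine Fin.ext ?_
      rw [← Nat.div_add_mod (j : ℕ) (i + 1), ← Nat.div_add_mod (l : ℕ) (i + 1), hij]
      exact congrArg (fun m => (i + 1) * m + _) hρ
  have h2 := tail_le_mul hX hY hσ (a := fun j => if j < 2 * s then u i else 0)
    (fun j l hjl => by
      have := hu0 i
      dsimp only
      split_ifs <;> first | omega | linarith)
    (fun j => by have := hu0 i; split_ifs <;> linarith) (hD R)
    ((hX.le_of_dominatedBy h1).trans (mul_le_of_le_one_right (hD _).le hux))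
  have e : (fun j : Fin n => if s ≤ (j : ℕ) then (if (j : ℕ) < 2 * s then u i else 0) else 0)
      = u i • fun j : Fin n => if s ≤ (j : ℕ) ∧ (j : ℕ) < 2 * s then 1 else 0 := by
    funext j
    simp only [Pi.smul_apply, smul_eq_mul, mul_ite, mul_one, mul_zero, ite_and]
  rw [e, hY.smul, abs_of_nonneg (hu0 i)] at h2
  refine h2.trans (mul_le_mul_of_nonneg_right ?_ hσ0.le)
  refine (domConst_le hX.one_le (Nat.le_add_left 1 _)).trans ?_
  refine mul_le_mul_of_nonneg_left ?_ (latticeConst_pos hX.one_le).le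
  refine pow_le_pow_left₀ (by positivity) ?_ _
  have h3 : ((2 * s / (i + 1) : ℕ) : ℝ) ≤ 2 * s / (i + 1) := by
    have := Nat.cast_div_le (α := ℝ) (m := 2 * s) (n := i + 1)
    push_cast at this
    exact this
  have h4 : (1 : ℝ) ≤ s / (i + 1) := by
    rw [one_le_div (by positivity)]
    exact_mod_cast his
  push_cast
  have e2 : (6 * s / (i + 1) : ℝ) = 2 * (2 * s / (i + 1)) + 2 * (s / (i + 1)) := by ring
  rw [e2]
  linarith

theorem prod_range_div_eq (t γ : ℕ) (H a : ℝ) :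
    ∏ j ∈ Finset.range t, H * (a / (j + 1)) ^ γ = H ^ t * (a ^ t / t.factorial) ^ γ := by
  rw [Finset.prod_mul_distrib, Finset.prod_const, Finset.card_range, Finset.prod_pow,
    Finset.prod_div_distrib, Finset.prod_const, Finset.card_range,
    ← Finset.prod_range_add_one_eq_factorial]
  push_cast
  rfl

/-- The constant in the upper estimate of the entropy numbers. -/
noncomputable def upperConst (C : ℝ) (A : ℕ) : ℝ :=
  C * (domConst C 2 * domConst C (A + 1) + domConst C 1)

/-- Every vector in the unit ball of `NX` is close in `NY` to `l • z`, with `z` from a set of sparse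
integer vectors: the `s / A` largest coordinates are rounded to multiples of the mesh size `l`, and
the other ones are replaced by zero. -/
theorem exists_int_approx (hX : IsSymmQuasiNorm NX C) (hY : IsSymmQuasiNorm NY C) (hσ0 : 0 < σ)
    (hσ : ∀ a : ℕ → ℝ, Antitone a → (∀ i, 0 ≤ a i) → NX (fun i => a i) ≤ 1 →
      NY (fun i => if s ≤ (i : ℕ) then a i else 0) ≤ σ)
    (hs1 : 1 ≤ s) (hs : 2 * s < n) (hA : 1 ≤ A) :
    ∃ l : ℝ, ∀ x, NX x ≤ 1 → ∃ z : Fin n → ℤ,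
      (Finset.univ.filter fun i => z i ≠ 0).card ≤ s / A ∧
      ∏ i, (1 + |(z i : ℝ)|) ≤ (1 + latticeConst C) ^ (s / A)
        * ((6 * s : ℝ) ^ (s / A) / (s / A).factorial) ^ growthExp C ∧
      NY (x - l • fun i => (z i : ℝ)) ≤ upperConst C A * σ := by
  classical
  set f : Fin n → ℝ := fun j => if s ≤ (j : ℕ) ∧ (j : ℕ) < 2 * s then 1 else 0 with hf
  have hY0 : 0 < NY f := by
    refine lt_of_le_of_ne (hY.nonneg _) fun h => ?_
    have h1 := congrFun ((hY.eq_zero_iff _).1 h.symm) ⟨s, by omega⟩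
    rw [hf] at h1
    dsimp only at h1
    rw [if_pos ⟨le_rfl, by omega⟩] at h1
    exact one_ne_zero h1
  -- an error of `l` in each of `s` coordinates has size `σ` in `NY`
  set l := σ / NY f with hl
  have hl0 : 0 < l := by positivity
  have hD := domConst_pos hX.one_le
  have hLat := latticeConst_pos hX.one_le
  refine ⟨l, fun x hx => ?_⟩
  obtain ⟨u, π, hu, hu0, hxu⟩ := exists_antitone_rearrangement x
  have hux : NX (fun i => u i) ≤ 1 := by
    refine le_of_eq_of_le (hX.symm x _ π fun i => ?_).symm hx
    rw [hxu, abs_of_nonneg (hu0 _)]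
  have htail := shorter_tail_le hX hY hσ hs hA hx hu hu0 hxu
  set t := s / A with ht
  have hts : t ≤ s := Nat.div_le_self _ _
  choose g hg1 hg2 using exists_int_abs_le
  let z : Fin n → ℤ := fun i => if (π i : ℕ) < t then g (x i / l) else 0
  have hzlt : ∀ i, z i ≠ 0 → (π i : ℕ) < t := fun i hi => by
    by_contra hc; exact hi (if_neg hc)
  refine ⟨z, ?_, ?_, ?_⟩
  · calc (Finset.univ.filter fun i => z i ≠ 0).card
        ≤ (Finset.univ.filter fun i : Fin n => (i : ℕ) < t).card :=
          Finset.card_le_card_of_injOn π (fun i hi => by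
            simp only [Finset.coe_filter, Finset.mem_univ, true_and, Set.mem_ofPred_eq] at hi ⊢
            exact hzlt i hi) π.injective.injOn
      _ ≤ t := by rw [Fin.card_filter_val_lt]; exact min_le_right _ _
  · have hbound : ∀ i, 1 + |(z i : ℝ)| ≤ if (π i : ℕ) < t then
        (1 + latticeConst C) * (6 * s / ((π i : ℕ) + 1) : ℝ) ^ growthExp C else 1 := by
      intro i
      by_cases hi : (π i : ℕ) < t
      · rw [if_pos hi]
        have h1 := coord_mul_le hX hY hσ0 hσ hu hu0 hux (hi.trans_le hts) hs
        have h2 : |x i / l| ≤ latticeConst C * (6 * s / ((π i : ℕ) + 1) : ℝ) ^ growthExp C := by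
          rw [abs_div, abs_of_pos hl0, hxu, hl, div_div_eq_mul_div, div_le_iff₀ hσ0]
          exact h1
        have h3 : (1 : ℝ) ≤ (6 * s / ((π i : ℕ) + 1) : ℝ) ^ growthExp C := by
          refine one_le_pow₀ ?_
          rw [one_le_div (by positivity)]
          have : ((π i : ℕ) : ℝ) + 1 ≤ s := by exact_mod_cast hi.trans_le hts
          linarith
        have h4 : |(z i : ℝ)| ≤ |x i / l| := by
          simp only [z, if_pos hi]; exact hg1 _
        linarith
      · simp [z, hi]
    refine (Finset.prod_le_prod (fun i _ => by positivity) fun i _ => hbound i).trans ?_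
    rw [Equiv.prod_comp π (fun j : Fin n => if (j : ℕ) < t then
      (1 + latticeConst C) * (6 * s / ((j : ℕ) + 1) : ℝ) ^ growthExp C else 1),
      Fin.prod_univ_eq_prod_range (fun j => if j < t then
      (1 + latticeConst C) * (6 * s / ((j : ℕ) + 1) : ℝ) ^ growthExp C else 1) n,
      ← Finset.prod_filter, ← prod_range_div_eq]
    refine le_of_eq (Finset.prod_congr ?_ fun _ _ => rfl)
    ext j
    simp only [Finset.mem_filter, Finset.mem_range]
    omega
  · have e : x - l • (fun i => (z i : ℝ)) = (fun i => if t ≤ (π i : ℕ) then x i else 0)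
        + fun i => if (π i : ℕ) < t then x i - l * z i else 0 := by
      funext i
      by_cases hi : (π i : ℕ) < t
      · simp [hi]
      · simp [hi, z, not_lt.1 hi]
    have hhead : NY (fun i => if (π i : ℕ) < t then x i - l * z i else 0) ≤ domConst C 1 * σ := by
      have h1 : DominatedBy 1 (fun i => if (π i : ℕ) < t then x i - l * z i else 0) (l • f) := by
        have hlt : ∀ i, (π i : ℕ) < t → s + (π i : ℕ) < n := fun i hi => by omega
        have hne : ∀ i, (if (π i : ℕ) < t then x i - l * z i else 0) ≠ 0 → (π i : ℕ) < t :=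
          fun i hi => by by_contra hc; exact hi (if_neg hc)
        refine ⟨fun i => if h : (π i : ℕ) < t then ⟨_, hlt i h⟩ else i, fun _ => 0,
          fun i hi => ⟨one_pos, ?_⟩, fun i j hi hj hij _ => ?_⟩
        · have hi' := hne i hi
          dsimp only
          rw [if_pos hi', dif_pos hi', Pi.smul_apply, hf]
          dsimp only
          rw [if_pos ⟨by omega, by omega⟩, smul_eq_mul, mul_one, abs_of_pos hl0]
          have h2 : x i - l * z i = l * (x i / l - g (x i / l)) := by
            simp only [z, if_pos hi']
            field_simp
          rw [h2, abs_mul, abs_of_pos hl0]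
          exact mul_le_of_le_one_right hl0.le (hg2 _)
        · dsimp only at hij
          rw [dif_pos (hne i hi), dif_pos (hne j hj), Fin.mk.injEq] at hij
          exact π.injective (Fin.ext (by omega))
      refine (hY.le_of_dominatedBy h1).trans (le_of_eq ?_)
      rw [hY.smul, abs_of_pos hl0, hl, div_mul_cancel₀ _ hY0.ne']
    rw [e]
    refine (hY.add_le _ _).trans ?_
    have := mul_le_mul_of_nonneg_left (add_le_add htail hhead) hY.pos.le
    refine this.trans (le_of_eq ?_)
    unfold upperConst
    ring

end

/-! ### The size of the covering net -/

section

open Filter Topology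

/-- The size of the covering net, with density parameter `x = s / (A * n)`, is at most
`2 ^ (k - 1)` when `A` is large: its logarithm is `O((s / A) * (log A + log (n / k + 1)))`, and
`s * log (n / k + 1)` is at most `2 * k`. -/
theorem exists_scale {H : ℝ} (hH : 1 ≤ H) (γ : ℕ) : ∃ A : ℕ, 2 ≤ A ∧ ∀ n k s : ℕ,
    1 ≤ k → 2 * k < n → A ≤ s → s ≤ k → ((s : ℝ) - 1) * Real.log ((n : ℝ) / k + 1) ≤ k →
    (k : ℝ) < s * Real.log ((n : ℝ) / k + 1) →
    ((s / (A * n) : ℝ) ^ (s / A))⁻¹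
      * (H ^ (s / A) * ((6 * s : ℝ) ^ (s / A) / (s / A).factorial) ^ γ) ^ 2
      * (1 + 2 * (s / (A * n) : ℝ)) ^ n ≤ ((2 ^ (k - 1) : ℕ) : ℝ) := by
  -- the value of `A` is such that the exponent in the final estimate is at most `k / 2`
  obtain ⟨A, hA2, hA⟩ : ∃ A : ℕ, 2 ≤ A ∧
      2 * ((1 + 2 * γ) * Real.log A + (2 * Real.log H + 2 * γ * (Real.log 6 + 1) + 2) + 2)
        ≤ Real.log 2 / 2 * A := by
    set c := (2 * Real.log H + 2 * γ * (Real.log 6 + 1) + 2) + 2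
    have h1 : Tendsto (fun A : ℕ => Real.log (A : ℝ) / A) atTop (𝓝 0) := by
      have := (Real.isLittleO_log_id_atTop.tendsto_div_nhds_zero).comp tendsto_natCast_atTop_atTop
      exact this
    have h2 : Tendsto (fun A : ℕ => c / (A : ℝ)) atTop (𝓝 0) :=
      tendsto_const_div_atTop_nhds_zero_nat c
    have h3 : Tendsto (fun A : ℕ => 2 * ((1 + 2 * γ) * (Real.log (A : ℝ) / A) + c / A))
        atTop (𝓝 0) := by
      simpa using ((h1.const_mul (1 + 2 * (γ : ℝ))).add h2).const_mul 2
    have hlog : 0 < Real.log 2 / 2 := by have := Real.log_pos one_lt_two; positivity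
    obtain ⟨A, h4, h5⟩ := ((h3.eventually (gt_mem_nhds hlog)).and (eventually_ge_atTop 2)).exists
    refine ⟨A, h5, ?_⟩
    have hA0 : (0 : ℝ) < A := by exact_mod_cast (by omega : 0 < A)
    have h6 := mul_le_mul_of_nonneg_right h4.le hA0.le
    refine le_trans (le_of_eq ?_) h6
    simp only [c]
    field_simp
    ring
  refine ⟨A, hA2, fun n k s hk hkn hAs hsk hs1 hs2 => ?_⟩
  set L := Real.log ((n : ℝ) / k + 1) with hL
  set t := s / A with ht
  set τ : ℝ := s / A with hτ
  have hk0 : (0 : ℝ) < k := by exact_mod_cast hk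
  have hA0 : (0 : ℝ) < A := by exact_mod_cast (by omega : 0 < A)
  have hA1 : (1 : ℝ) ≤ A := by exact_mod_cast (by omega : 1 ≤ A)
  have hs0 : (0 : ℝ) < s := by exact_mod_cast (by omega : 0 < s)
  have hs2' : (2 : ℝ) ≤ s := by exact_mod_cast (by omega : 2 ≤ s)
  have hn0 : (0 : ℝ) < n := by exact_mod_cast (by omega : 0 < n)
  have hnk : 2 < (n : ℝ) / k := by rw [lt_div_iff₀ hk0]; exact_mod_cast hkn
  have hL1 : 1 ≤ L := by
    rw [hL, Real.le_log_iff_exp_le (by linarith)]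
    linarith [Real.exp_one_lt_d9]
  have hτ0 : 0 < τ := by positivity
  have htτ : (t : ℝ) ≤ τ := Nat.cast_div_le
  have hlogA : 0 ≤ Real.log A := Real.log_nonneg hA1
  have hlogH : 0 ≤ Real.log H := Real.log_nonneg hH
  have hlog6 : 0 ≤ Real.log 6 := Real.log_nonneg (by norm_num)
  have hx : (s / (A * n) : ℝ) = τ / n := by rw [hτ, div_div]
  have hsn : (s : ℝ) ≤ n := by exact_mod_cast (by omega : s ≤ n)
  -- the reciprocal of the density of the supports
  have hlogx : Real.log (n / τ) ≤ Real.log A + 2 * L := by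
    have h1 : (n : ℝ) / τ ≤ A * ((n / k + 1) * L) := by
      rw [div_le_iff₀ hτ0, hτ]
      have h2 : (n : ℝ) = n / k * k := by field_simp
      calc (n : ℝ) = n / k * k := h2
        _ ≤ (n / k + 1) * (s * L) := by gcongr; linarith
        _ = _ := by field_simp
    have h0 : 0 < (n : ℝ) / k + 1 := by linarith
    calc Real.log (n / τ) ≤ Real.log (A * ((n / k + 1) * L)) :=
          Real.log_le_log (by positivity) h1
      _ = Real.log A + (L + Real.log L) := by
          rw [Real.log_mul (by positivity) (by positivity), Real.log_mul (by positivity)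
            (by positivity)]
      _ ≤ Real.log A + 2 * L := by linarith [Real.log_le_self (by linarith : 0 ≤ L)]
  have hfac : (s : ℝ) ^ t / t.factorial ≤ Real.exp (τ * (Real.log A + 1)) := by
    have h1 : (s : ℝ) ^ t = A ^ t * τ ^ t := by rw [← mul_pow, hτ]; congr 1; field_simp
    have h2 : τ ^ t / t.factorial ≤ Real.exp τ := Real.pow_div_factorial_le_exp _ hτ0.le _
    have h3 : (A : ℝ) ^ t ≤ Real.exp (τ * Real.log A) := by
      rw [← Real.exp_log hA0, ← Real.exp_nat_mul, Real.exp_log hA0]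
      exact Real.exp_le_exp.2 (mul_le_mul_of_nonneg_right htτ hlogA)
    rw [h1, mul_div_assoc, mul_add, mul_one, Real.exp_add]
    exact mul_le_mul h3 h2 (by positivity) (Real.exp_pos _).le
  have hpow : ∀ {a : ℝ}, 1 ≤ a → a ^ t ≤ Real.exp (τ * Real.log a) := by
    intro a ha
    have ha0 : 0 < a := by linarith
    calc a ^ t = Real.exp (t * Real.log a) := by rw [Real.exp_nat_mul, Real.exp_log ha0]
      _ ≤ _ := Real.exp_le_exp.2 (mul_le_mul_of_nonneg_right htτ (Real.log_nonneg ha))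
  have hτn : τ ≤ n := (div_le_self hs0.le hA1).trans hsn
  have e1 : ((s / (A * n) : ℝ) ^ t)⁻¹ ≤ Real.exp (τ * (Real.log A + 2 * L)) := by
    rw [hx, ← inv_pow, inv_div]
    refine (hpow ((one_le_div hτ0).2 hτn)).trans (Real.exp_le_exp.2 ?_)
    exact mul_le_mul_of_nonneg_left hlogx hτ0.le
  have e2 : (6 * s : ℝ) ^ t / t.factorial ≤ Real.exp (τ * (Real.log 6 + Real.log A + 1)) := by
    rw [mul_pow, mul_div_assoc, show τ * (Real.log 6 + Real.log A + 1)
      = τ * Real.log 6 + τ * (Real.log A + 1) by ring, Real.exp_add]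
    exact mul_le_mul (hpow (by norm_num)) hfac (by positivity) (Real.exp_pos _).le
  have e3 : (H ^ t * ((6 * s : ℝ) ^ t / t.factorial) ^ γ) ^ 2
      ≤ Real.exp (τ * (2 * Real.log H + 2 * γ * (Real.log 6 + Real.log A + 1))) := by
    have h1 : H ^ t * ((6 * s : ℝ) ^ t / t.factorial) ^ γ
        ≤ Real.exp (τ * Real.log H) * Real.exp (τ * (Real.log 6 + Real.log A + 1)) ^ γ :=
      mul_le_mul (hpow hH) (pow_le_pow_left₀ (by positivity) e2 _) (by positivity)
        (Real.exp_pos _).le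
    refine (pow_le_pow_left₀ (by positivity) h1 2).trans (le_of_eq ?_)
    rw [← Real.exp_nat_mul, ← Real.exp_add, ← Real.exp_nat_mul]
    congr 1
    push_cast
    ring
  have e4 : (1 + 2 * (s / (A * n) : ℝ)) ^ n ≤ Real.exp (τ * 2) := by
    have h1 : 1 + 2 * (s / (A * n) : ℝ) ≤ Real.exp (2 * (τ / n)) := by
      rw [hx, add_comm]; exact Real.add_one_le_exp _
    refine (pow_le_pow_left₀ (by positivity) h1 n).trans (le_of_eq ?_)
    rw [← Real.exp_nat_mul]
    congr 1
    field_simp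
  have hτL : τ * L * A ≤ 2 * k := by
    rw [hτ]
    have : (s : ℝ) / A * L * A = s * L := by field_simp
    rw [this]
    nlinarith
  set c := 2 * Real.log H + 2 * γ * (Real.log 6 + 1) + 2 with hc
  have hc0 : 0 ≤ c := by positivity
  have hfin : τ * (Real.log A + 2 * L)
      + τ * (2 * Real.log H + 2 * γ * (Real.log 6 + Real.log A + 1)) + τ * 2
      ≤ k / 2 * Real.log 2 := by
    have h1 : (1 + 2 * γ) * Real.log A + c + 2 * L
        ≤ ((1 + 2 * γ) * Real.log A + c + 2) * L := by
      have : 0 ≤ (1 + 2 * γ) * Real.log A + c := by positivity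
      nlinarith
    have h2 : (0 : ℝ) ≤ (1 + 2 * γ) * Real.log A + c + 2 := by positivity
    have h3 : τ * ((1 + 2 * γ) * Real.log A + c + 2 * L) * A ≤ k / 2 * Real.log 2 * A := by
      calc τ * ((1 + 2 * γ) * Real.log A + c + 2 * L) * A
          ≤ τ * (((1 + 2 * γ) * Real.log A + c + 2) * L) * A := by gcongr
        _ = (τ * L * A) * ((1 + 2 * γ) * Real.log A + c + 2) := by ring
        _ ≤ (2 * k) * ((1 + 2 * γ) * Real.log A + c + 2) := by gcongr
        _ = k * (2 * ((1 + 2 * γ) * Real.log A + c + 2)) := by ring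
        _ ≤ k * (Real.log 2 / 2 * A) := by gcongr
        _ = _ := by ring
    refine le_trans (le_of_eq ?_) (le_of_mul_le_mul_right h3 hA0)
    rw [hc]; ring
  calc _ ≤ Real.exp (τ * (Real.log A + 2 * L))
        * Real.exp (τ * (2 * Real.log H + 2 * γ * (Real.log 6 + Real.log A + 1)))
        * Real.exp (τ * 2) := by gcongr
    _ ≤ Real.exp (k / 2 * Real.log 2) := by
        rw [← Real.exp_add, ← Real.exp_add]; exact Real.exp_le_exp.2 hfin
    _ ≤ Real.exp (((k - 1 : ℕ) : ℝ) * Real.log 2) := by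
        refine Real.exp_le_exp.2 (mul_le_mul_of_nonneg_right ?_ (Real.log_pos one_lt_two).le)
        rw [Nat.cast_sub hk]
        have : (2 : ℝ) ≤ k := by exact_mod_cast (by omega : 2 ≤ k)
        push_cast
        linarith
    _ = _ := by rw [Real.exp_nat_mul, Real.exp_log two_pos]; push_cast; rfl

end

/-! ### Entropy numbers -/

theorem IsQuasiNorm.mono {E : Type*} [AddCommGroup E] [Module ℝ E] {N : E → ℝ} {C C' : ℝ}
    (h : IsQuasiNorm N C) (hC : C ≤ C') : IsQuasiNorm N C' where
  one_le := h.one_le.trans hC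
  nonneg := h.nonneg
  eq_zero_iff := h.eq_zero_iff
  smul := h.smul
  add_le x y := (h.add_le x y).trans
    (mul_le_mul_of_nonneg_right hC (add_nonneg (h.nonneg x) (h.nonneg y)))

section

variable {n : ℕ} {E : Type*} [AddCommGroup E] [Module ℝ E] {b : Module.Basis (Fin n) ℝ E}
  {NX NY : E → ℝ} {C : ℝ}

/-- In coordinates, a quasi-norm with a symmetric basis is a symmetric quasi-norm on `ℝⁿ`. -/
theorem IsSymmetricBasis.isSymmQuasiNorm (hb : IsSymmetricBasis NX b) (hX : IsQuasiNorm NX C) :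
    IsSymmQuasiNorm (fun a => NX (b.equivFun.symm a)) C where
  one_le := hX.one_le
  nonneg _ := hX.nonneg _
  eq_zero_iff a := by rw [hX.eq_zero_iff, LinearEquiv.map_eq_zero_iff]
  smul c a := by rw [map_smul, hX.smul]
  add_le a a' := by rw [map_add]; exact hX.add_le _ _
  symm x y π hxy := by
    rw [Module.Basis.equivFun_symm_apply, Module.Basis.equivFun_symm_apply]
    have h := hb y (fun i => if x i = y (π i) then 1 else -1) π
      (fun i => by split_ifs <;> simp)
    rw [h]
    congr 1
    refine Finset.sum_congr rfl fun i _ => ?_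
    congr 1
    split_ifs with hi
    · rw [hi, one_mul]
    · rw [neg_one_mul]
      exact (abs_eq_abs.1 (hxy i)).resolve_left hi

theorem bestTermError_le_of_support (hY : IsQuasiNorm NY C) {s : ℕ} (x : E) {a z : Fin n → ℝ}
    (ha : a = b.equivFun x) (hz : (Finset.univ.filter fun i => z i ≠ 0).card ≤ s) :
    bestTermError NY b s x ≤ NY (b.equivFun.symm (a - z)) := by
  refine csInf_le ⟨0, ?_⟩ ⟨b.equivFun.symm z, ?_, ?_⟩
  · rintro _ ⟨z, _, rfl⟩
    exact hY.nonneg _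
  · refine le_trans (Finset.card_le_card fun i hi => ?_) hz
    rw [Finsupp.mem_support_iff, ← Module.Basis.equivFun_apply, LinearEquiv.apply_symm_apply] at hi
    exact Finset.mem_filter.2 ⟨Finset.mem_univ _, hi⟩
  · rw [map_sub, ha, LinearEquiv.symm_apply_apply]

/-- The error of best `s`-term approximation is at most the quasi-norm of the tail of the
non-increasing rearrangement. -/
theorem bestTermError_le_tail (hb : IsSymmetricBasis NY b) (hY : IsQuasiNorm NY C) {s : ℕ}
    (x : E) {u : ℕ → ℝ} {π : Equiv.Perm (Fin n)} (hu0 : ∀ i, 0 ≤ u i)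
    (hxu : ∀ i, |b.equivFun x i| = u (π i)) :
    bestTermError NY b s x
      ≤ NY (b.equivFun.symm fun i => if s ≤ (i : ℕ) then u i else 0) := by
  classical
  refine (bestTermError_le_of_support hY x (b := b)
    (z := fun i => if (π i : ℕ) < s then b.equivFun x i else 0) rfl ?_).trans (le_of_eq ?_)
  · calc _ ≤ (Finset.univ.filter fun i : Fin n => (i : ℕ) < s).card :=
          Finset.card_le_card_of_injOn π (fun i hi => by
            simp only [Finset.coe_filter, Finset.mem_univ, true_and, Set.mem_ofPred_eq] at hi ⊢
            by_contra hc
            exact hi (if_neg hc)) π.injective.injOn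
      _ ≤ s := by rw [Fin.card_filter_val_lt]; exact min_le_right _ _
  · refine (hb.isSymmQuasiNorm hY).symm _ _ π fun i => ?_
    rw [Pi.sub_apply]
    by_cases hi : (π i : ℕ) < s
    · simp [hi, not_le.2 hi]
    · rw [if_neg hi, if_pos (not_lt.1 hi), sub_zero, hxu, abs_of_nonneg (hu0 _)]

theorem tail_le_bestTermError (hb : IsSymmetricBasis NY b) (hY : IsQuasiNorm NY C) {s : ℕ}
    {u : ℕ → ℝ} (hu : Antitone u) (hu0 : ∀ i, 0 ≤ u i) :
    NY (b.equivFun.symm fun i => if s ≤ (i : ℕ) then u i else 0)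
      ≤ domConst C 1 * bestTermError NY b s (b.equivFun.symm fun i => u i) := by
  have hD := domConst_pos hY.one_le 1
  rw [← div_le_iff₀' hD]
  refine le_csInf ⟨_, 0, by simp, rfl⟩ ?_
  rintro _ ⟨z, hz, rfl⟩
  rw [div_le_iff₀' hD]
  have h := (hb.isSymmQuasiNorm hY).tail_le hu hu0 (s := s) (b.equivFun z) (by
    refine le_trans (Finset.card_le_card fun i hi => ?_) hz
    rw [Finsupp.mem_support_iff, ← Module.Basis.equivFun_apply]
    exact (Finset.mem_filter.1 hi).2)
  refine h.trans (le_of_eq ?_)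
  have e : (fun i : Fin n => u i - b.equivFun z i) = (fun i : Fin n => u i) - b.equivFun z := rfl
  rw [e, map_sub, LinearEquiv.symm_apply_apply]

theorem mem_entropyRadii_id_iff (hY : IsQuasiNorm NY C) {k : ℕ} {ε : ℝ} :
    ε ∈ entropyRadii NX NY LinearMap.id k ↔
      0 < ε ∧ ∃ y : Fin (2 ^ (k - 1)) → E, ∀ x, NX x ≤ 1 → ∃ i, NY (x - y i) ≤ ε := by
  refine and_congr_right fun hε => exists_congr fun y => ?_
  constructor
  · intro h x hx
    obtain ⟨i, z, hz, hzx⟩ := Set.mem_iUnion.1 (h ⟨x, hx, rfl⟩)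
    refine ⟨i, ?_⟩
    have e : x - y i = ε • z := by
      rw [LinearMap.id_apply] at hzx
      rw [← hzx]; simp
    have hz1 : NY z ≤ 1 := hz
    rw [e, hY.smul, abs_of_pos hε]
    exact mul_le_of_le_one_right hε.le hz1
  · rintro h _ ⟨x, hx, rfl⟩
    obtain ⟨i, hi⟩ := h x hx
    refine Set.mem_iUnion.2 ⟨i, ε⁻¹ • (x - y i), ?_, ?_⟩
    · change NY _ ≤ 1
      rw [hY.smul, abs_of_pos (by positivity), inv_mul_le_iff₀ hε, mul_one]
      exact hi
    · simp [smul_smul, hε.ne']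

/-- The lower estimate of the entropy numbers. -/
theorem sSup_bestTermError_le (hX : IsQuasiNorm NX C) (hY : IsQuasiNorm NY C)
    (hbX : IsSymmetricBasis NX b) (hbY : IsSymmetricBasis NY b) {k s : ℕ} (hk : 1 ≤ k)
    (hkn : 2 * k < n) (hs : 1 ≤ s) (hsk : s ≤ k)
    (hL : (k : ℝ) < s * Real.log ((n : ℝ) / k + 1)) :
    (lowerConst C)⁻¹ * sSup (bestTermError NY b s '' quasiUnitBall NX)
      ≤ entropyNumber NX NY LinearMap.id k := by
  have hK := lowerConst_pos hX.one_le
  refine le_csInf (hbX.entropyRadii_nonempty hX hY k) fun ε hε => ?_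
  obtain ⟨hε0, y, hy⟩ := (mem_entropyRadii_id_iff hY).1 hε
  rw [inv_mul_le_iff₀ hK]
  have hne : (bestTermError NY b s '' quasiUnitBall NX).Nonempty :=
    ⟨_, 0, by change NX 0 ≤ 1; rw [hX.map_zero]; exact zero_le_one, rfl⟩
  refine csSup_le hne ?_
  rintro _ ⟨x, hx, rfl⟩
  have hx1 : NX x ≤ 1 := hx
  obtain ⟨u, π, hu, hu0, hxu⟩ := exists_antitone_rearrangement (b.equivFun x)
  have hSX := hbX.isSymmQuasiNorm hX
  have hSY := hbY.isSymmQuasiNorm hY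
  refine (bestTermError_le_tail hbY hY x hu0 hxu).trans ?_
  refine sorted_tail_le_of_cover (NX := fun a => NX (b.equivFun.symm a))
    (NY := fun a => NY (b.equivFun.symm a)) (y := fun i => b.equivFun (y i)) hSX hSY hε0
    (fun a ha => ?_) hu hu0 ?_ hk hkn hs hsk hL
  · obtain ⟨i, hi⟩ := hy _ ha
    refine ⟨i, ?_⟩
    rwa [map_sub, LinearEquiv.symm_apply_apply]
  · refine le_of_eq_of_le (hSX.symm (b.equivFun x) _ π fun i => ?_).symm ?_
    · rw [hxu, abs_of_nonneg (hu0 _)]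
    · rwa [LinearEquiv.symm_apply_apply]

/-- The upper estimate, provided that the covering net is small enough. -/
theorem entropyNumber_le (hX : IsQuasiNorm NX C) (hY : IsQuasiNorm NY C)
    (hbX : IsSymmetricBasis NX b) (hbY : IsSymmetricBasis NY b) {k s A : ℕ} (hA : 1 ≤ A)
    (hs1 : 1 ≤ s) (hs : 2 * s < n)
    (hcount : A ≤ s → ((s / (A * n) : ℝ) ^ (s / A))⁻¹ * ((1 + latticeConst C) ^ (s / A)
      * ((6 * s : ℝ) ^ (s / A) / (s / A).factorial) ^ growthExp C) ^ 2
      * (1 + 2 * (s / (A * n) : ℝ)) ^ n ≤ ((2 ^ (k - 1) : ℕ) : ℝ)) :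
    entropyNumber NX NY LinearMap.id k
      ≤ upperConst C A * domConst C 1 * sSup (bestTermError NY b s '' quasiUnitBall NX) := by
  classical
  have hSX := hbX.isSymmQuasiNorm hX
  have hSY := hbY.isSymmQuasiNorm hY
  have hD := domConst_pos hX.one_le
  have hC := hSX.pos
  set S := sSup (bestTermError NY b s '' quasiUnitBall NX) with hS
  set σ := domConst C 1 * S with hσdef
  have hσ : ∀ a : ℕ → ℝ, Antitone a → (∀ i, 0 ≤ a i) →
      NX (b.equivFun.symm fun i => a i) ≤ 1 →
      NY (b.equivFun.symm fun i => if s ≤ (i : ℕ) then a i else 0) ≤ σ := fun a ha ha0 ha1 =>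
    (tail_le_bestTermError hbY hY ha ha0).trans (mul_le_mul_of_nonneg_left
      (le_csSup (hbX.bddAbove_bestTermError hX hY s) ⟨_, ha1, rfl⟩) (hD 1).le)
  have hσ0 : 0 < σ := by
    -- a constant vector has a nonzero tail
    have hne : ∀ p : Fin n → Prop, ∀ [DecidablePred p], p ⟨s, by omega⟩ →
        (fun i => if p i then (1 : ℝ) else 0) ≠ 0 := fun p _ hp h => by
      have := congrFun h ⟨s, by omega⟩
      simp only [if_pos hp, Pi.zero_apply, one_ne_zero] at this
    have hX0 : 0 < NX (b.equivFun.symm fun _ : Fin n => (1 : ℝ)) := by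
      refine lt_of_le_of_ne (hX.nonneg _) fun h => hne (fun _ => True) trivial ?_
      simpa using (hSX.eq_zero_iff _).1 h.symm
    have h1 := tail_le_mul hSX hSY hσ (a := fun _ => 1) (fun _ _ _ => le_rfl)
      (fun _ => zero_le_one) hX0 le_rfl
    have h2 : 0 < NY (b.equivFun.symm fun i : Fin n => if s ≤ (i : ℕ) then (1 : ℝ) else 0) := by
      refine lt_of_le_of_ne (hY.nonneg _) fun h => hne (fun i => s ≤ (i : ℕ)) le_rfl ?_
      exact (hSY.eq_zero_iff _).1 h.symm
    exact pos_of_mul_pos_right (h2.trans_le h1) hX0.le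
  obtain ⟨l, hl⟩ := exists_int_approx hSX hSY hσ0 hσ hs1 hs hA
  set P := (1 + latticeConst C) ^ (s / A)
    * ((6 * s : ℝ) ^ (s / A) / (s / A).factorial) ^ growthExp C with hP
  obtain ⟨Z, hZ, hZcard⟩ : ∃ Z : Finset (Fin n → ℤ), (∀ z : Fin n → ℤ,
      (Finset.univ.filter fun i => z i ≠ 0).card ≤ s / A → ∏ i, (1 + |(z i : ℝ)|) ≤ P → z ∈ Z) ∧
      Z.card ≤ 2 ^ (k - 1) := by
    rcases lt_or_ge s A with hsA | hsA
    -- for `s < A` no coordinate is kept, so that one ball suffices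
    · refine ⟨{0}, fun z hz _ => ?_, by simpa using Nat.one_le_two_pow⟩
      rw [Nat.div_eq_of_lt hsA, Nat.le_zero, Finset.card_eq_zero, Finset.filter_eq_empty_iff] at hz
      rw [Finset.mem_singleton]
      funext i
      simpa using hz (Finset.mem_univ i)
    · have hs0 : (0 : ℝ) < s := by exact_mod_cast hs1
      have hA0 : (1 : ℝ) ≤ A := by exact_mod_cast hA
      have hsn : (s : ℝ) ≤ n := by exact_mod_cast (by omega : s ≤ n)
      have hn0 : (0 : ℝ) < n := by linarith
      obtain ⟨Z, h1, h2⟩ := exists_finset_sparse n (s / A) (P := P) (x := (s / (A * n) : ℝ))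
        (by positivity) (by rw [div_le_one (by positivity)]; nlinarith)
      exact ⟨Z, h1, by exact_mod_cast h2.trans (hcount hsA)⟩
  obtain ⟨f⟩ : Nonempty (Z ↪ Fin (2 ^ (k - 1))) :=
    Function.Embedding.nonempty_of_card_le (by simpa using hZcard)
  have hU : 0 < upperConst C A := by
    have := hD 2; have := hD (A + 1); have := hD 1
    unfold upperConst; positivity
  rw [mul_assoc]
  refine csInf_le ⟨0, fun ε hε => hε.1.le⟩ ((mem_entropyRadii_id_iff hY).2 ⟨by positivity,
    fun j => b.equivFun.symm (l • fun i => (Function.extend f Subtype.val 0 j i : ℝ)),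
    fun x hx => ?_⟩)
  obtain ⟨z, h1, h2, h3⟩ := hl (b.equivFun x) (by rwa [LinearEquiv.symm_apply_apply])
  refine ⟨f ⟨z, hZ z h1 h2⟩, ?_⟩
  dsimp only
  rw [f.injective.extend_apply]
  rwa [map_sub, LinearEquiv.symm_apply_apply] at h3

end

theorem mainTheorem6 (C : ℝ) :
    ∃ c₁ : ℝ, 0 < c₁ ∧ ∃ c₂ : ℝ, 0 < c₂ ∧
      ∀ (n : ℕ) (E : Type*) [AddCommGroup E] [Module ℝ E] (b : Module.Basis (Fin n) ℝ E)
        (NX NY : E → ℝ) (CX CY : ℝ),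
        IsQuasiNorm NX CX → IsQuasiNorm NY CY → max CX CY ≤ C →
        IsSymmetricBasis NX b → IsSymmetricBasis NY b →
        ∀ k s : ℕ, 1 ≤ k → (k : ℝ) < (n : ℝ) / 2 →
          IsLeast {m : ℕ | (k : ℝ) / Real.log ((n : ℝ) / (k : ℝ) + 1) < (m : ℝ)} s →
          c₁ * sSup (bestTermError NY b s '' quasiUnitBall NX)
              ≤ entropyNumber NX NY LinearMap.id k ∧
            entropyNumber NX NY LinearMap.id k
              ≤ c₂ * sSup (bestTermError NY b s '' quasiUnitBall NX) := by
  rcases lt_or_ge C 1 with hC | hC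
  · -- there are no quasi-norms with constants below `1`
    refine ⟨1, one_pos, 1, one_pos, fun n E _ _ b NX NY CX CY hX _ hCC => ?_⟩
    exact absurd (hX.one_le.trans ((le_max_left _ _).trans hCC)) (not_le.2 hC)
  have hLat := latticeConst_pos hC
  obtain ⟨A, hA2, hA⟩ := exists_scale (H := 1 + latticeConst C) (by linarith) (growthExp C)
  have hU : 0 < upperConst C A * domConst C 1 := by
    have hD := domConst_pos hC
    have := hD 2; have := hD (A + 1); have := hD 1
    unfold upperConst; positivity
  refine ⟨(lowerConst C)⁻¹, inv_pos.2 (lowerConst_pos hC), _, hU, ?_⟩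
  intro n E _ _ b NX NY CX CY hX hY hCC hbX hbY k s hk hkn hs
  have hX' := hX.mono ((le_max_left _ _).trans hCC)
  have hY' := hY.mono ((le_max_right _ _).trans hCC)
  have hk0 : (0 : ℝ) < k := by exact_mod_cast hk
  have hkn' : 2 * k < n := by
    have : (2 * k : ℝ) < n := by linarith
    exact_mod_cast this
  have hnk : 2 < (n : ℝ) / k := by rw [lt_div_iff₀ hk0]; exact_mod_cast hkn'
  have hL1 : 1 < Real.log ((n : ℝ) / k + 1) := by
    rw [Real.lt_log_iff_exp_lt (by linarith)]
    linarith [Real.exp_one_lt_d9]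
  set L := Real.log ((n : ℝ) / k + 1) with hL
  have hL0 : 0 < L := by linarith
  have hs1 : 1 ≤ s := by
    have h1 : (k : ℝ) / L < s := hs.1
    have h2 : (0 : ℝ) < s := lt_trans (by positivity) h1
    exact_mod_cast h2
  have hsk : s ≤ k := hs.2 (show (k : ℝ) / L < k from div_lt_self hk0 hL1)
  have hkL : (k : ℝ) < s * L := (div_lt_iff₀ hL0).1 hs.1
  have hsL : ((s : ℝ) - 1) * L ≤ k := by
    by_contra! hc
    have h1 : (k : ℝ) / L < ((s - 1 : ℕ) : ℝ) := by
      rw [Nat.cast_sub hs1, div_lt_iff₀ hL0]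
      exact_mod_cast hc
    have := hs.2 h1
    omega
  exact ⟨sSup_bestTermError_le hX' hY' hbX hbY hk hkn' hs1 hsk hkL,
    entropyNumber_le hX' hY' hbX hbY (by omega) hs1 (by omega)
      fun hAs => hA n k s hk hkn' hAs hsk hsL hkL⟩
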